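/- Let $\mathbb F_q$ be a finite field with $q$ elements and let $N, M \ge 1$ be integers. Let $H$ be a vector space over $\mathbb F_q$ of dimension $N+M$, and fix a subspace $h \subseteq H$ of dimension $M$. The attenuated space poset $\mathcal A_q(N,M)$ is the set $X$ of all subspaces $y \subseteq H$ with $y \cap h = 0$, ordered by inclusion; $y$ covers $z$ if $z \subsetneq y$ and no $w \in X$ satisfies $z \subsetneq w \subsetneq y$. Let $V = \mathbb C^X$, and let $A \in \mathrm{Mat}_X(\mathbb C)$ be the $q$-adjacency matrix: $A_{y,z} = 1$ if $y$ covers $z$, $A_{y,z} = q^{\dim y}$ if $z$ covers $y$, and $A_{y,z} = 0$ otherwise. Let $A^* \in \mathrm{Mat}_X(\mathbb C)$ be the diagonal matrix with $(y,y)$-entry $q^{-\dim y}$. For $0 \le i \le N$ let $E^*_i$ be the diagonal matrix with $(y,y)$-entry $1$ if $\dim y = i$ and $0$ otherwise, and let $\mathbf M^*$ be the subalgebra of $\mathrm{Mat}_X(\mathbb C)$ generated by (equivalently, with basis) $E^*_0, \dots, E^*_N$. For $i \in \{0, \tfrac12, 1, \tfrac32, \dots, N\}$ put $$\theta_i = \frac{q^{N-i}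 - q^i}{q-1}\, q^{M/2},$$ and let $E_iV = \{v \in V : Av = \theta_i v\}$. Let $V_0 < V_1 < \dots < V_D$ be an ordering of the eigenspaces of $A$ (each eigenspace is listed exactly once). A dual adjacency matrix for this ordering is a matrix $\mathbf A^*$ that generates $\mathbf M^*$ and satisfies $\mathbf A^* V_i \subseteq V_{i-1} + V_i + V_{i+1}$ for $0 \le i \le D$, where $V_{-1} = V_{D+1} = 0$. The ordering is called $Q$-polynomial if it has a dual adjacency matrix, and $A$ is called $Q$-polynomial if it is diagonalizable and has a $Q$-polynomial ordering of its eigenspaces. Theorem. The matrix $A$ is diagonalizable, and each of the following two sequences is an ordering of the eigenspaces of $A$ (in particular $A$ has exactly $2N+1$ eigenspaces, with the mutually distinct eigenvalues $\theta_i$): (i) $E_0V < E_1V < \cdots < E_NV < E_{1/2}V < E_{3/2}V < \cdots < E_{N-1/2}V$; (ii) $E_{1/2}V < E_{3/2}V < \cdots < E_{N-1/2}V < E_0V < E_1V < \cdots < E_NV$. The matrix $A^*$ is a dual adjacency matrix for both orderings (i) and (ii). Consequently both orderings are $Q$-polynomial, and the matrix $A$ is $Q$-polynomial. -/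

import Mathlib

/-! ### The attenuated space poset and its matrices -/

namespace AttenuatedSpace

variable {F H : Type*} [Field F] [AddCommGroup H] [Module F H]

/-- The vertex set `X` of the attenuated space poset: the subspaces of `H` having zero intersection
with the fixed subspace `h`.  As a subtype it carries the inclusion order, so that `z ⋖ y` means
that `y` covers `z` inside `X`. -/
abbrev Vertex (h : Submodule F H) : Type _ := {y : Submodule F H // y ⊓ h = ⊥}

noncomputable instance instFintypeVertex [Finite F] [Module.Finite F H] (h : Submodule F H) :
    Fintype (Vertex h) :=
  haveI : Finite H := Module.finite_of_finite F
  Fintype.ofFinite _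

/-- The dimension (rank) of a vertex. -/
noncomputable def dim {h : Submodule F H} (y : Vertex h) : ℕ := Module.finrank F y.1

open Classical in
/-- The `q`-adjacency matrix `A`, where `q = |F|`: the `(y, z)`-entry is `1` if `y` covers `z`,
`q ^ dim y` if `z` covers `y`, and `0` if neither covers the other. -/
noncomputable def qAdjMatrix (h : Submodule F H) : Matrix (Vertex h) (Vertex h) ℂ :=
  Matrix.of fun y z =>
    if z ⋖ y then 1
    else if y ⋖ z then (Nat.card F : ℂ) ^ dim y
    else 0

/-- The diagonal matrix `A*`, with `(y, y)`-entry `q ^ (- dim y)`. -/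
noncomputable def dualMatrix (h : Submodule F H) : Matrix (Vertex h) (Vertex h) ℂ :=
  Matrix.diagonal fun y => (Nat.card F : ℂ) ^ (-(dim y : ℤ))

/-- The diagonal matrix `E*_i`, which projects onto the `i`-th subconstituent. -/
noncomputable def dualIdempotent (h : Submodule F H) (i : ℕ) :
    Matrix (Vertex h) (Vertex h) ℂ :=
  Matrix.diagonal fun y => if dim y = i then 1 else 0

/-- The subalgebra `M*` of `Mat_X(ℂ)` generated by `E*_0, ..., E*_N`.  The `E*_i` are orthogonal
idempotents with sum `1`, so this is their linear span. -/
noncomputable def dualAlgebra [Finite F] [Module.Finite F H] (h : Submodule F H) (N : ℕ) :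
    Subalgebra ℂ (Matrix (Vertex h) (Vertex h) ℂ) :=
  Algebra.adjoin ℂ {B | ∃ i : ℕ, i ≤ N ∧ B = dualIdempotent h i}

/-- The scalar `θ_i = (q ^ (N - i) - q ^ i) / (q - 1) * q ^ (M / 2)`, for a (half-integer) index `i`.
All powers are real powers of `q > 0`. -/
noncomputable def theta (q N M : ℕ) (i : ℚ) : ℝ :=
  ((q : ℝ) ^ ((N : ℝ) - (i : ℝ)) - (q : ℝ) ^ (i : ℝ)) / ((q : ℝ) - 1) * (q : ℝ) ^ ((M : ℝ) / 2)

/-- The subspace `E_i V` of the standard module `V = ℂ^X`: the eigenspace of `A` for `θ_i`. -/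
noncomputable def eigenspaceA [Finite F] [Module.Finite F H] (h : Submodule F H) (N M : ℕ)
    (i : ℚ) : Submodule ℂ (Vertex h → ℂ) :=
  Module.End.eigenspace (qAdjMatrix h).mulVecLin ((theta (Nat.card F) N M i : ℝ) : ℂ)

/-- The index sequence `0, 1, ..., N, 1/2, 3/2, ..., N - 1/2`. -/
def indexIntFirst (N : ℕ) (k : Fin (2 * N + 1)) : ℚ :=
  if (k : ℕ) ≤ N then (k : ℚ) else (k : ℚ) - N - 1 / 2

/-- The index sequence `1/2, 3/2, ..., N - 1/2, 0, 1, ..., N`. -/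
def indexHalfFirst (N : ℕ) (k : Fin (2 * N + 1)) : ℚ :=
  if (k : ℕ) < N then (k : ℚ) + 1 / 2 else (k : ℚ) - N

end AttenuatedSpace

/-! ### The `Q`-polynomial property

Here `A` is a square matrix indexed by a finite set `X`, and `S` is the subalgebra of `Mat_X(ℂ)`
that dual adjacency matrices are required to generate. -/

namespace QPolynomial

variable {X : Type*} [Fintype X] [DecidableEq X]

/-- `A` is diagonalizable: the standard module is the sum of the eigenspaces of `A`. -/
def IsDiagonalizable (A : Matrix X X ℂ) : Prop :=
  ⨆ μ : ℂ, Module.End.eigenspace A.mulVecLin μ = ⊤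

/-- `V_0, ..., V_{n-1}` is an ordering of the eigenspaces of `A`: every eigenspace of `A` (for an
eigenvalue of `A`) occurs exactly once, and nothing else occurs. -/
def IsEigenspaceOrdering (A : Matrix X X ℂ) {n : ℕ} (V : Fin n → Submodule ℂ (X → ℂ)) : Prop :=
  Function.Injective V ∧
    Set.range V = {W | ∃ μ : ℂ, Module.End.HasEigenvalue A.mulVecLin μ ∧
      W = Module.End.eigenspace A.mulVecLin μ}

/-- `B` is a dual adjacency matrix for the sequence of subspaces `V_0, ..., V_{n-1}`: it generates
the algebra `S`, and `B V_i ⊆ V_{i-1} + V_i + V_{i+1}` for all `i`, with `V_{-1} = V_n = 0`. -/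
def IsDualAdjacency (S : Subalgebra ℂ (Matrix X X ℂ)) {n : ℕ} (V : Fin n → Submodule ℂ (X → ℂ))
    (B : Matrix X X ℂ) : Prop :=
  Algebra.adjoin ℂ {B} = S ∧
    ∀ i : Fin n, (V i).map B.mulVecLin ≤
      ⨆ j : Fin n, ⨆ _ : (j : ℕ) ≤ (i : ℕ) + 1 ∧ (i : ℕ) ≤ (j : ℕ) + 1, V j

/-- A `Q`-polynomial ordering: an ordering of the eigenspaces of `A` that has a dual adjacency
matrix. -/
def IsQPolynomialOrdering (A : Matrix X X ℂ) (S : Subalgebra ℂ (Matrix X X ℂ)) {n : ℕ}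
    (V : Fin n → Submodule ℂ (X → ℂ)) : Prop :=
  IsEigenspaceOrdering A V ∧ ∃ B : Matrix X X ℂ, IsDualAdjacency S V B

/-- `A` is `Q`-polynomial: it is diagonalizable and its eigenspaces have a `Q`-polynomial
ordering. -/
def IsQPolynomial (A : Matrix X X ℂ) (S : Subalgebra ℂ (Matrix X X ℂ)) : Prop :=
  IsDiagonalizable A ∧
    ∃ (n : ℕ) (V : Fin n → Submodule ℂ (X → ℂ)), IsQPolynomialOrdering A S V

end QPolynomial

/-!
Write `q = |F|`, let `R` be the raising matrix, `L = Rᵀ` the lowering matrix and `K = A*`.  Then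
`A = R + K⁻¹ L`, and the proof rests on relations among `R`, `L` and `K` alone.

**The uniform poset relations.**  In the lattice of all subspaces `R L - L R` is diagonal.  In the
attenuated poset it is diagonal plus the adjacency matrix `S` of the sibling relation, which holds
for two vertices whose sum covers both of them but meets `h` (`raising_commutator`).  Counting
covers gives `L S = q S L + (q ^ M - 1) L` (`transpose_mul_sibling`), so that `S` can be eliminated;
the result is `(q + 1) L R L - q R L² - L² R = (q + 1) q ^ (N + M - 1) K L` (`uniform_lowering`)
and its transpose (`uniform_raising`).

**Tridiagonality.**  As `K R = q⁻¹ R K` and `K L = q L K`, these relations say exactly that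
`W = A² K - (q + q⁻¹) A K A + K A² - (q + 1)² q ^ (N + M - 2) K` commutes with `A`
(`tridiagonal_expression`, `casimir_commute`).  On `E_i V` the matrix `W` acts as
`(A - θ_{i+1}) (A - θ_{i-1}) K`, because `θ_{i±1}` are the roots of the corresponding quadratic.  So
`(A - θ_i) (A - θ_{i+1}) (A - θ_{i-1})` kills `K E_i V`, and `K E_i V` lies in
`E_{i-1} V + E_i V + E_{i+1} V` once `A` is known to be diagonalizable with eigenvalues among the
`θ_j`.

**The spectrum.**  Let `v` be homogeneous with `L v = 0` and `L R v = c v`, and let `d` be maximal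
with `R ^ d v ≠ 0`.  By `uniform_raising` the span of the ladder `v, R v, …, R ^ d v` is stable
under `L`, with explicit coefficients in which `c` is determined by `d` and the degree of `v`.
Identifying `R ^ i v`, suitably rescaled, with `z ^ i`, the equation `A f = λ f` becomes, up to a
scale factor in `λ`, the `q`-difference equation
`(1 - z²) f(q z) = (1 + λ z - q ^ d z²) f(z)`.  It is solved by the products
`∏_{k<j} (1 - q ^ k z) ∏_{k<d-j} (1 + q ^ k z)` with `λ = q ^ (d - j) - q ^ j`, for `0 ≤ j ≤ d`.
Hence the ladder is spanned by eigenvectors of `A` with the eigenvalues `θ_{(N-d)/2+j}`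
(`ladder_mem_iSup_eigenspace`).  The ladders span the standard module, since the orthogonal
complement of their span is stable under `R` and `L` and would contain the base of a ladder if it
were nonzero (`ladderOrthogonal_eq_bot`).  All `θ_i` occur: the zero subspace gives a ladder with
`d = N`, and a difference of two points `y`, `y'` with `y + h = y' + h` gives one with `d = N - 1`
(`eigenspaceA_ne_bot`).
-/

namespace AttenuatedSpace

open Module Matrix

/-! ### Counting covers and hyperplanes -/

section Counting

theorem card_sub_one_ne_zero (F : Type*) [Field F] [Finite F] : (Nat.card F : ℂ) - 1 ≠ 0 := by
  have : 1 < Nat.card F := Finite.one_lt_card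
  rw [sub_ne_zero]
  exact_mod_cast this.ne'

variable {F H : Type*} [Field F] [AddCommGroup H] [Module F H] [Module.Finite F H]

theorem covBy_iff_finrank {a b : Submodule F H} :
    a ⋖ b ↔ a ≤ b ∧ finrank F b = finrank F a + 1 := by
  constructor
  · intro hab
    refine ⟨hab.le, ?_⟩
    obtain ⟨x, hxb, hxa⟩ := SetLike.exists_of_lt hab.lt
    have hcov := Submodule.covBy_span_singleton_sup hxa
    have hle : F ∙ x ⊔ a ≤ b := sup_le (by simpa using hxb) hab.le
    have heq : F ∙ x ⊔ a = b := (hab.eq_or_eq hcov.le hle).resolve_left hcov.lt.ne'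
    have hx0 : x ≠ 0 := fun h0 => hxa (h0 ▸ a.zero_mem)
    have hinf : (F ∙ x) ⊓ a = ⊥ := by
      rw [← disjoint_iff, disjoint_comm, Submodule.disjoint_span_singleton' hx0]
      exact hxa
    have := Submodule.finrank_sup_add_finrank_inf_eq (F ∙ x) a
    rw [hinf, heq, finrank_bot, finrank_span_singleton hx0] at this
    omega
  · rintro ⟨hle, hfr⟩
    refine ⟨lt_of_le_of_ne hle (fun h => by rw [h] at hfr; omega), fun c hac hcb => ?_⟩
    have h1 := Submodule.finrank_lt_finrank_of_lt hac
    have h2 := Submodule.finrank_lt_finrank_of_lt hcb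
    omega

theorem ncard_eq_pow (y : Submodule F H) : (y : Set H).ncard = Nat.card F ^ finrank F y := by
  rw [← Nat.card_coe_set_eq]
  exact Module.natCard_eq_pow_finrank (K := F) (V := y)

variable [Finite F]

/-- Double counting of the vectors `x ∈ t ∖ y` according to the subspace `y + ⟨x⟩` they span
together with `y`. -/
theorem ncard_covBy_le_mul (y t : Submodule F H) (hyt : y ≤ t) :
    {w : Submodule F H | y ⋖ w ∧ w ≤ t}.ncard *
      (Nat.card F ^ (finrank F y + 1) - Nat.card F ^ finrank F y) =
      Nat.card F ^ finrank F t - Nat.card F ^ finrank F y := by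
  classical
  have : Finite H := Module.finite_of_finite F
  have : Fintype H := Fintype.ofFinite H
  have : Fintype (Submodule F H) := Fintype.ofFinite _
  have hdiff : ∀ w : Submodule F H, y ≤ w → (Finset.univ.filter fun x => x ∈ w ∧ x ∉ y).card =
      Nat.card F ^ finrank F w - Nat.card F ^ finrank F y := by
    intro w hw
    have h1 : ((w : Set H) \ y).ncard = _ := Set.ncard_sdiff (s := (y : Set H)) (t := w) hw
    rw [ncard_eq_pow, ncard_eq_pow] at h1
    rw [← h1, ← Set.ncard_coe_finset]
    congr 1
    ext x
    simp
  have key := Finset.card_eq_sum_card_fiberwise (s := Finset.univ.filter fun x => x ∈ t ∧ x ∉ y)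
    (t := Finset.univ.filter fun w : Submodule F H => y ⋖ w ∧ w ≤ t) (f := fun x => F ∙ x ⊔ y) (by
      intro x hx
      simp only [Finset.coe_filter, Finset.mem_univ, true_and, Set.mem_ofPred_eq] at hx ⊢
      exact ⟨Submodule.covBy_span_singleton_sup hx.2, sup_le (by simpa using hx.1) hyt⟩)
  rw [hdiff t hyt] at key
  rw [key, Finset.sum_congr rfl (g := fun _ =>
    (Nat.card F ^ (finrank F y + 1) - Nat.card F ^ finrank F y)), Finset.sum_const, smul_eq_mul]
  · congr 1
    rw [← Set.ncard_coe_finset]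
    congr 1
    ext x
    simp
  · intro w hw
    simp only [Finset.mem_filter, Finset.mem_univ, true_and] at hw
    rw [← (covBy_iff_finrank.1 hw.1).2, ← hdiff w hw.1.le]
    congr 1
    ext x
    simp only [Finset.mem_filter, Finset.mem_univ, true_and]
    constructor
    · rintro ⟨⟨-, hxy⟩, rfl⟩
      exact ⟨Submodule.mem_sup_left (Submodule.mem_span_singleton_self x), hxy⟩
    · rintro ⟨hxw, hxy⟩
      refine ⟨⟨hw.2 hxw, hxy⟩, ?_⟩
      have hcov := Submodule.covBy_span_singleton_sup hxy
      exact (hw.1.eq_or_eq hcov.le (sup_le (by simpa using hxw) hw.1.le)).resolve_left hcov.lt.ne'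

theorem ncard_covBy_le {y t : Submodule F H} (hyt : y ≤ t) {k : ℕ}
    (hk : finrank F t = finrank F y + k) :
    ({w : Submodule F H | y ⋖ w ∧ w ≤ t}.ncard : ℂ) =
      ((Nat.card F : ℂ) ^ k - 1) / ((Nat.card F : ℂ) - 1) := by
  have h := ncard_covBy_le_mul y t hyt
  have hq : 0 < Nat.card F := Nat.card_pos
  have hqC : (Nat.card F : ℂ) ≠ 0 := by exact_mod_cast hq.ne'
  have h' := congrArg (Nat.cast (R := ℂ)) h
  rw [Nat.cast_mul, Nat.cast_sub (Nat.pow_le_pow_right hq (by omega)),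
    Nat.cast_sub (Nat.pow_le_pow_right hq (by omega)), hk] at h'
  push_cast at h'
  have hq1 : (Nat.card F : ℂ) - 1 ≠ 0 := card_sub_one_ne_zero F
  rw [eq_div_iff hq1]
  have : (Nat.card F : ℂ) ^ finrank F y ≠ 0 := pow_ne_zero _ hqC
  apply mul_left_cancel₀ this
  rw [pow_add, pow_add] at h'
  linear_combination h'

/-- The number of hyperplanes of `y`, obtained from `ncard_covBy_le` by passing to annihilators in
the dual space of `y`. -/
theorem ncard_covBy_below (y : Submodule F H) :
    ({z : Submodule F H | z ⋖ y}.ncard : ℂ) =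
      ((Nat.card F : ℂ) ^ finrank F y - 1) / ((Nat.card F : ℂ) - 1) := by
  have h := ncard_covBy_le (F := F) (H := Dual F y) (y := ⊥) (t := ⊤) bot_le
    (k := finrank F y) (by simp [Subspace.dual_finrank_eq])
  rw [← h]
  congr 1
  let e : Submodule F y ≃o (Submodule F (Dual F y))ᵒᵈ := Subspace.orderIsoFiniteDimensional
  let g : Submodule F (Dual F y) → Submodule F H :=
    fun p => (e.symm (OrderDual.toDual p)).map y.subtype
  have hg : Function.Injective g := fun p p' hp => by
    have := Submodule.map_injective_of_injective y.injective_subtype hp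
    simpa using this
  rw [← Set.ncard_image_of_injective _ hg]
  congr 1
  ext z
  simp only [Set.mem_ofPred_eq, Set.mem_image]
  constructor
  · intro hz
    have hz' : z.comap y.subtype ⋖ ⊤ := by
      rw [covBy_iff_finrank] at hz ⊢
      refine ⟨le_top, ?_⟩
      rw [finrank_top, hz.2, LinearEquiv.finrank_eq (Submodule.comapSubtypeEquivOfLe hz.1)]
    refine ⟨OrderDual.ofDual (e (z.comap y.subtype)), ⟨?_, le_top⟩, ?_⟩
    · have := (apply_covBy_apply_iff e).2 hz'
      rw [e.map_top] at this
      exact this.ofDual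
    · simp [g, Submodule.map_comap_subtype, hz.le]
  · rintro ⟨p, ⟨hp, -⟩, rfl⟩
    have h1 : e.symm (OrderDual.toDual p) ⋖ ⊤ := by
      rw [← apply_covBy_apply_iff e, e.map_top, e.apply_symm_apply]
      exact hp.toDual
    have := Submodule.map_covBy_of_injective y.injective_subtype h1
    simpa [g] using this

end Counting

/-! ### Vertices, siblings and the raising matrix -/

section Vertices

variable {F H : Type*} [Field F] [AddCommGroup H] [Module F H] {h : Submodule F H}

theorem Vertex.covBy_iff {y z : Vertex h} : y ⋖ z ↔ y.1 ⋖ z.1 := by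
  refine (Set.OrdConnected.apply_covBy_apply_iff
    (OrderEmbedding.subtype fun y : Submodule F H => y ⊓ h = ⊥) ?_).symm
  constructor
  rintro _ ⟨a, rfl⟩ _ ⟨b, rfl⟩ c hc
  exact ⟨⟨c, le_bot_iff.1 ((inf_le_inf_right h hc.2).trans b.2.le)⟩, rfl⟩

/-- Two vertices are siblings if their sum covers both of them but is not a vertex. -/
def IsSibling (h y z : Submodule F H) : Prop :=
  y ⋖ y ⊔ z ∧ z ⋖ y ⊔ z ∧ (y ⊔ z) ⊓ h ≠ ⊥

/-- The only candidate for a common cover of `a ≠ b` is `a ⊔ b`. -/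
theorem ncard_covers_both {a b : Submodule F H} (hab : a ≠ b) [Decidable (a ⋖ a ⊔ b ∧ b ⋖ a ⊔ b)]
    (p : Submodule F H → Prop) [Decidable (p (a ⊔ b))] :
    ({z : Submodule F H | p z ∧ a ⋖ z ∧ b ⋖ z}.ncard : ℂ) =
      if a ⋖ a ⊔ b ∧ b ⋖ a ⊔ b then (if p (a ⊔ b) then 1 else 0) else 0 := by
  have hz : ∀ z, a ⋖ z → b ⋖ z → z = a ⊔ b := fun z ha hb => by
    rcases ha.eq_or_eq le_sup_left (sup_le ha.le hb.le) with h1 | h1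
    · rcases hb.eq_or_eq le_sup_right (sup_le ha.le hb.le) with h2 | h2
      · exact absurd (h1.symm.trans h2) hab
      · exact h2.symm
    · exact h1.symm
  split_ifs with h1 h2
  · rw [show {z : Submodule F H | p z ∧ a ⋖ z ∧ b ⋖ z} = {a ⊔ b} from ?_, Set.ncard_singleton,
      Nat.cast_one]
    ext z
    simp only [Set.mem_ofPred_eq, Set.mem_singleton_iff]
    exact ⟨fun h' => hz z h'.2.1 h'.2.2, by rintro rfl; exact ⟨h2, h1⟩⟩
  · rw [show {z : Submodule F H | p z ∧ a ⋖ z ∧ b ⋖ z} = ∅ from ?_, Set.ncard_empty, Nat.cast_zero]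
    ext z
    simp only [Set.mem_ofPred_eq, Set.mem_empty_iff_false, iff_false]
    rintro ⟨hp, ha, hb⟩
    exact h2 (hz z ha hb ▸ hp)
  · rw [show {z : Submodule F H | p z ∧ a ⋖ z ∧ b ⋖ z} = ∅ from ?_, Set.ncard_empty, Nat.cast_zero]
    ext z
    simp only [Set.mem_ofPred_eq, Set.mem_empty_iff_false, iff_false]
    rintro ⟨hp, ha, hb⟩
    exact h1 (hz z ha hb ▸ ⟨ha, hb⟩)

theorem ncard_covered_by_both {a b : Submodule F H} (ha : a ⊓ h = ⊥) (hab : a ≠ b)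
    [Decidable (a ⋖ a ⊔ b ∧ b ⋖ a ⊔ b)] :
    ({z : Submodule F H | z ⊓ h = ⊥ ∧ z ⋖ a ∧ z ⋖ b}.ncard : ℂ) =
      if a ⋖ a ⊔ b ∧ b ⋖ a ⊔ b then 1 else 0 := by
  have hz : ∀ z, z ⋖ a → z ⋖ b → z = a ⊓ b := fun z ha hb => by
    rcases ha.eq_or_eq (le_inf ha.le hb.le) inf_le_left with h1 | h1
    · exact h1.symm
    · rcases hb.eq_or_eq (le_inf ha.le hb.le) inf_le_right with h2 | h2
      · exact h2.symm
      · exact absurd (h1.symm.trans h2) hab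
  have hmod : (a ⋖ a ⊔ b ∧ b ⋖ a ⊔ b) ↔ (a ⊓ b ⋖ a ∧ a ⊓ b ⋖ b) :=
    ⟨fun h' => ⟨inf_covBy_of_covBy_sup_right h'.2, inf_covBy_of_covBy_sup_left h'.1⟩,
      fun h' => ⟨covBy_sup_of_inf_covBy_right h'.2, covBy_sup_of_inf_covBy_left h'.1⟩⟩
  split_ifs with h1
  · rw [show {z : Submodule F H | z ⊓ h = ⊥ ∧ z ⋖ a ∧ z ⋖ b} = {a ⊓ b} from ?_, Set.ncard_singleton,
      Nat.cast_one]
    ext z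
    simp only [Set.mem_ofPred_eq, Set.mem_singleton_iff]
    refine ⟨fun h' => hz z h'.2.1 h'.2.2, ?_⟩
    rintro rfl
    exact ⟨le_bot_iff.1 ((inf_le_inf_right h inf_le_left).trans ha.le), hmod.1 h1⟩
  · rw [show {z : Submodule F H | z ⊓ h = ⊥ ∧ z ⋖ a ∧ z ⋖ b} = ∅ from ?_, Set.ncard_empty,
      Nat.cast_zero]
    ext z
    simp only [Set.mem_ofPred_eq, Set.mem_empty_iff_false, iff_false]
    rintro ⟨-, ha, hb⟩
    exact h1 (hmod.2 (hz z ha hb ▸ ⟨ha, hb⟩))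

variable [Module.Finite F H]

theorem Vertex.dim_eq_of_covBy {y z : Vertex h} (hyz : y ⋖ z) : dim z = dim y + 1 :=
  (covBy_iff_finrank.1 (Vertex.covBy_iff.1 hyz)).2

theorem finrank_sup_of_inf_eq_bot {y : Submodule F H} (hy : y ⊓ h = ⊥) :
    finrank F ↥(y ⊔ h) = finrank F y + finrank F h := by
  have := Submodule.finrank_sup_add_finrank_inf_eq y h
  rwa [hy, finrank_bot, add_zero] at this

theorem Vertex.dim_le {N M : ℕ} (hH : finrank F H = N + M) (hh : finrank F h = M) (y : Vertex h) :
    dim y ≤ N := by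
  have h1 := finrank_sup_of_inf_eq_bot y.2
  have h2 := Submodule.finrank_le (y.1 ⊔ h)
  unfold dim
  omega

/-- A cover of a vertex `y` fails to be a vertex exactly if it lies in `y + h`. -/
theorem inf_ne_bot_iff_le_sup {y w : Submodule F H} (hy : y ⊓ h = ⊥) (hyw : y ⋖ w) :
    w ⊓ h ≠ ⊥ ↔ w ≤ y ⊔ h := by
  constructor
  · intro hw
    obtain ⟨x, hx, hx0⟩ := Submodule.exists_mem_ne_zero_of_ne_bot hw
    have hxy : x ∉ y := fun hxy => hx0 <| by
      have : x ∈ y ⊓ h := ⟨hxy, hx.2⟩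
      rwa [hy, Submodule.mem_bot] at this
    have hcov := Submodule.covBy_span_singleton_sup hxy
    have heq := (hyw.eq_or_eq hcov.le (sup_le (by simpa using hx.1) hyw.le)).resolve_left
      hcov.lt.ne'
    rw [← heq, sup_comm]
    exact sup_le_sup_left (by simpa using hx.2) y
  · intro hle hw
    have h1 := finrank_sup_of_inf_eq_bot hy
    have h2 := finrank_sup_of_inf_eq_bot hw
    have h3 : w ⊔ h = y ⊔ h := le_antisymm (sup_le hle le_sup_right) (sup_le_sup_right hyw.le h)
    rw [h3] at h2
    have := (covBy_iff_finrank.1 hyw).2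
    omega

/-- When `y + w` meets `h`, the space `y + h` cuts out a cover of `y` in `y + w` and a subspace of
dimension `dim y` in `w`. -/
theorem finrank_inf_sup_of_sup_covBy {y w : Submodule F H} (hy : y ⊓ h = ⊥) (hw : w ⊓ h = ⊥)
    (hdim : finrank F w = finrank F y + 1) (hcov : w ⋖ y ⊔ w) (hh : (y ⊔ w) ⊓ h ≠ ⊥) :
    finrank F ↥((y ⊔ w) ⊓ (y ⊔ h)) = finrank F y + 1 ∧
      finrank F ↥(w ⊓ (y ⊔ h)) = finrank F y := by
  have hle : y ⊔ w ≤ w ⊔ h := (inf_ne_bot_iff_le_sup hw hcov).1 hh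
  have h1 := finrank_sup_of_inf_eq_bot hy
  have h2 := finrank_sup_of_inf_eq_bot hw
  have e1 : y ⊔ w ⊔ (y ⊔ h) = w ⊔ h :=
    le_antisymm (sup_le hle (sup_le (le_sup_left.trans hle) le_sup_right))
      (sup_le (le_sup_right.trans le_sup_left) (le_sup_right.trans le_sup_right))
  have e2 : w ⊔ (y ⊔ h) = w ⊔ h :=
    le_antisymm (sup_le le_sup_left (sup_le (le_sup_left.trans hle) le_sup_right))
      (sup_le le_sup_left (le_sup_right.trans le_sup_right))
  have h3 := Submodule.finrank_sup_add_finrank_inf_eq (y ⊔ w) (y ⊔ h)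
  have h4 := Submodule.finrank_sup_add_finrank_inf_eq w (y ⊔ h)
  have h5 := (covBy_iff_finrank.1 hcov).2
  rw [e1] at h3
  rw [e2] at h4
  omega

theorem siblings_above_of_covBy {y w : Submodule F H} (hw : w ⊓ h = ⊥) (hyw : y ⋖ w) :
    {z : Submodule F H | z ⊓ h = ⊥ ∧ y ⋖ z ∧ IsSibling h z w} =
      {z : Submodule F H | z ⊓ h = ⊥ ∧ y ⋖ z ∧ z ≤ w ⊔ h} \ {w} := by
  ext z
  simp only [Set.mem_ofPred_eq, Set.mem_sdiff, Set.mem_singleton_iff]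
  constructor
  · rintro ⟨hz, hyz, hs⟩
    refine ⟨⟨hz, hyz, ?_⟩, ?_⟩
    · exact le_sup_left.trans ((inf_ne_bot_iff_le_sup hw hs.2.1).1 hs.2.2)
    · rintro rfl
      exact hs.2.1.lt.ne (by simp)
  · rintro ⟨⟨hz, hyz, hle⟩, hne⟩
    have hinf : z ⊓ w = y := (hyz.eq_or_eq (le_inf hyz.le hyw.le) inf_le_left).resolve_right
      fun h' => hne <| (hyw.eq_or_eq hyz.le (inf_eq_left.1 h')).resolve_left hyz.lt.ne'
    have hc : w ⋖ z ⊔ w := covBy_sup_of_inf_covBy_left (hinf ▸ hyz)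
    exact ⟨hz, hyz, covBy_sup_of_inf_covBy_right (hinf ▸ hyw), hc,
      (inf_ne_bot_iff_le_sup hw hc).2 (sup_le hle le_sup_left)⟩

theorem siblings_above_of_not_covBy {y w : Submodule F H} (hyw : ¬ y ≤ w)
    (hdim : finrank F w = finrank F y + 1) (hcov : w ⋖ y ⊔ w) (hh : (y ⊔ w) ⊓ h ≠ ⊥) :
    {z : Submodule F H | z ⊓ h = ⊥ ∧ y ⋖ z ∧ IsSibling h z w} =
      {z : Submodule F H | z ⊓ h = ⊥ ∧ y ⋖ z ∧ z ≤ y ⊔ w} := by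
  ext z
  simp only [Set.mem_ofPred_eq]
  refine and_congr_right fun hz => and_congr_right fun hyz => ?_
  constructor
  · rintro ⟨-, hwz, -⟩
    have := (hwz.eq_or_eq le_sup_right (sup_le_sup_right hyz.le w)).resolve_left hcov.lt.ne'
    rw [this]
    exact le_sup_left
  · intro hle
    have hzw : ¬ z ≤ w := fun h' => hyw (hyz.le.trans h')
    have heq : z ⊔ w = y ⊔ w := (hcov.eq_or_eq le_sup_right (sup_le hle le_sup_right)).resolve_left
      fun h' => hzw (sup_eq_right.1 h')
    have h1 := (covBy_iff_finrank.1 hyz).2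
    have h2 := (covBy_iff_finrank.1 hcov).2
    unfold IsSibling
    rw [heq]
    exact ⟨covBy_iff_finrank.2 ⟨hle, by omega⟩, hcov, hh⟩

theorem siblings_below_of_not_covBy {y w : Submodule F H} (hy : y ⊓ h = ⊥) (hw : w ⊓ h = ⊥)
    (hyw : ¬ y ≤ w) (hdim : finrank F w = finrank F y + 1) (hcov : w ⋖ y ⊔ w)
    (hh : (y ⊔ w) ⊓ h ≠ ⊥) :
    {z : Submodule F H | z ⊓ h = ⊥ ∧ IsSibling h y z ∧ z ⋖ w} = {w ⊓ (y ⊔ h)} := by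
  obtain ⟨h1, h2⟩ := finrank_inf_sup_of_sup_covBy hy hw hdim hcov hh
  ext z
  simp only [Set.mem_ofPred_eq, Set.mem_singleton_iff]
  constructor
  · rintro ⟨hz, hs, hzw⟩
    have hle : z ≤ w ⊓ (y ⊔ h) :=
      le_inf hzw.le (le_sup_right.trans ((inf_ne_bot_iff_le_sup hy hs.1).1 hs.2.2))
    refine Submodule.eq_of_le_of_finrank_eq hle ?_
    have := (covBy_iff_finrank.1 hzw).2
    omega
  · rintro rfl
    have hsup : y ⊔ w ⊓ (y ⊔ h) ≤ (y ⊔ w) ⊓ (y ⊔ h) :=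
      sup_le (le_inf le_sup_left le_sup_left) (inf_le_inf_right _ le_sup_right)
    have hlt : y < y ⊔ w ⊓ (y ⊔ h) := lt_of_le_of_ne le_sup_left fun h' => hyw <| by
      have : w ⊓ (y ⊔ h) ≤ y := sup_eq_left.1 h'.symm
      rw [← Submodule.eq_of_le_of_finrank_eq this h2]
      exact inf_le_left
    have h3 := Submodule.finrank_lt_finrank_of_lt hlt
    have h4 := Submodule.finrank_mono hsup
    have hc : y ⋖ y ⊔ w ⊓ (y ⊔ h) := covBy_iff_finrank.2 ⟨le_sup_left, by omega⟩
    exact ⟨le_bot_iff.1 ((inf_le_inf_right h inf_le_left).trans hw.le),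
      ⟨hc, covBy_iff_finrank.2 ⟨le_sup_right, by omega⟩,
        (inf_ne_bot_iff_le_sup hy hc).2 (hsup.trans inf_le_right)⟩,
      covBy_iff_finrank.2 ⟨inf_le_left, by omega⟩⟩

theorem sup_covBy_of_sibling_above {y z w : Submodule F H} (hyw : ¬ y ⋖ w) (hyz : y ⋖ z)
    (hs : IsSibling h z w) :
    ¬ y ≤ w ∧ finrank F w = finrank F y + 1 ∧ w ⋖ y ⊔ w ∧ (y ⊔ w) ⊓ h ≠ ⊥ := by
  have h1 := (covBy_iff_finrank.1 hyz).2
  have h2 := (covBy_iff_finrank.1 hs.1).2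
  have h3 := (covBy_iff_finrank.1 hs.2.1).2
  have hn : ¬ y ≤ w := fun h' => hyw (covBy_iff_finrank.2 ⟨h', by omega⟩)
  have heq : y ⊔ w = z ⊔ w :=
    (hs.2.1.eq_or_eq le_sup_right (sup_le_sup_right hyz.le w)).resolve_left
      fun h' => hn (sup_eq_right.1 h')
  rw [heq]
  exact ⟨hn, by omega, hs.2.1, hs.2.2⟩

theorem sup_covBy_of_sibling_below {y z w : Submodule F H} (hw : w ⊓ h = ⊥) (hs : IsSibling h y z)
    (hzw : z ⋖ w) :
    ¬ y ≤ w ∧ finrank F w = finrank F y + 1 ∧ w ⋖ y ⊔ w ∧ (y ⊔ w) ⊓ h ≠ ⊥ := by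
  have h1 := (covBy_iff_finrank.1 hzw).2
  have h2 := (covBy_iff_finrank.1 hs.1).2
  have h3 := (covBy_iff_finrank.1 hs.2.1).2
  have hn : ¬ y ≤ w := fun h' => hs.2.2 <|
    le_bot_iff.1 ((inf_le_inf_right h (sup_le h' hzw.le)).trans hw.le)
  have hlt : y ⊓ w < y := lt_of_le_of_ne inf_le_left fun h' => hn (inf_eq_left.1 h')
  have h4 := Submodule.finrank_lt_finrank_of_lt hlt
  have h5 := Submodule.finrank_mono (inf_le_inf_left y hzw.le)
  have h6 := Submodule.finrank_sup_add_finrank_inf_eq y z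
  have h7 := Submodule.finrank_sup_add_finrank_inf_eq y w
  exact ⟨hn, by omega, covBy_iff_finrank.2 ⟨le_sup_right, by omega⟩, fun h' => hs.2.2 <|
    le_bot_iff.1 ((inf_le_inf_right h (sup_le_sup_left hzw.le y)).trans h'.le)⟩

variable [Finite F]

theorem sum_vertex_ite (p : Submodule F H → Prop) [DecidablePred p] :
    (∑ z : Vertex h, if p z.1 then (1 : ℂ) else 0) =
      ({z : Submodule F H | z ⊓ h = ⊥ ∧ p z}.ncard : ℂ) := by
  rw [Finset.sum_boole]
  congr 1
  rw [← Set.ncard_coe_finset, ← Set.ncard_image_of_injective _ Subtype.val_injective]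
  congr 1
  ext z
  simp [and_comm]

/-- The number of covers of a vertex `y` that lie below a subspace `t ≥ y`: the covers of `y` that
fail to be vertices are those contained in `y + h`. -/
theorem ncard_vertex_covBy_le {y t : Submodule F H} (hy : y ⊓ h = ⊥) (hyt : y ≤ t) {k l : ℕ}
    (hk : finrank F t = finrank F y + k)
    (hl : finrank F ↥(t ⊓ (y ⊔ h)) = finrank F y + l) :
    ({w : Submodule F H | w ⊓ h = ⊥ ∧ y ⋖ w ∧ w ≤ t}.ncard : ℂ) =
      ((Nat.card F : ℂ) ^ k - (Nat.card F : ℂ) ^ l) / ((Nat.card F : ℂ) - 1) := by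
  have hfin : Finite H := Module.finite_of_finite F
  have h1 := ncard_covBy_le hyt hk
  have h2 := ncard_covBy_le (le_inf hyt le_sup_left) hl
  have hset : {w : Submodule F H | w ⊓ h = ⊥ ∧ y ⋖ w ∧ w ≤ t} =
      {w : Submodule F H | y ⋖ w ∧ w ≤ t} \ {w : Submodule F H | y ⋖ w ∧ w ≤ t ⊓ (y ⊔ h)} := by
    ext w
    simp only [Set.mem_ofPred_eq, Set.mem_sdiff, le_inf_iff]
    constructor
    · rintro ⟨hw, hyw, hwt⟩
      exact ⟨⟨hyw, hwt⟩, fun h' => (inf_ne_bot_iff_le_sup hy hyw).2 h'.2.2 hw⟩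
    · rintro ⟨⟨hyw, hwt⟩, hn⟩
      refine ⟨?_, hyw, hwt⟩
      by_contra hw
      exact hn ⟨hyw, hwt, (inf_ne_bot_iff_le_sup hy hyw).1 hw⟩
  have hsub : {w : Submodule F H | y ⋖ w ∧ w ≤ t ⊓ (y ⊔ h)} ⊆ {w : Submodule F H | y ⋖ w ∧ w ≤ t} :=
    fun w hw => ⟨hw.1, hw.2.trans inf_le_left⟩
  rw [hset, Set.ncard_sdiff hsub, Nat.cast_sub (Set.ncard_le_ncard hsub), h1, h2]
  ring

open Classical in
/-- The raising matrix `R`: `(R v)(y)` is the sum of `v(z)` over the vertices `z` covered by `y`.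
Its transpose is the lowering matrix. -/
noncomputable def raising (h : Submodule F H) : Matrix (Vertex h) (Vertex h) ℂ :=
  Matrix.of fun y z => if z.1 ⋖ y.1 then 1 else 0

open Classical in
/-- The adjacency matrix of the sibling relation. -/
noncomputable def sibling (h : Submodule F H) : Matrix (Vertex h) (Vertex h) ℂ :=
  Matrix.of fun y z => if IsSibling h y.1 z.1 then 1 else 0

/-- The diagonal part of `R Rᵀ - Rᵀ R`: the number of hyperplanes of `y` minus the number of
covers of `y`.  The subtraction in the exponent does not truncate, as `dim y ≤ N`. -/
noncomputable def updownDiagonal (h : Submodule F H) (N M : ℕ) : Matrix (Vertex h) (Vertex h) ℂ :=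
  Matrix.diagonal fun y => (((Nat.card F : ℂ) ^ dim y - 1) -
    ((Nat.card F : ℂ) ^ (N + M - dim y) - (Nat.card F : ℂ) ^ M)) / ((Nat.card F : ℂ) - 1)

theorem raising_mul_transpose_apply (y w : Vertex h) :
    (raising h * (raising h)ᵀ) y w =
      ({z : Submodule F H | z ⊓ h = ⊥ ∧ z ⋖ y.1 ∧ z ⋖ w.1}.ncard : ℂ) := by
  classical
  rw [← sum_vertex_ite, Matrix.mul_apply]
  refine Finset.sum_congr rfl fun z _ => ?_
  simp [raising, ← ite_and, and_comm]

theorem transpose_mul_raising_apply (y w : Vertex h) :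
    ((raising h)ᵀ * raising h) y w =
      ({z : Submodule F H | z ⊓ h = ⊥ ∧ y.1 ⋖ z ∧ w.1 ⋖ z}.ncard : ℂ) := by
  classical
  rw [← sum_vertex_ite, Matrix.mul_apply]
  refine Finset.sum_congr rfl fun z _ => ?_
  simp [raising, ← ite_and, and_comm]

theorem transpose_mul_sibling_apply (y w : Vertex h) :
    ((raising h)ᵀ * sibling h) y w =
      ({z : Submodule F H | z ⊓ h = ⊥ ∧ y.1 ⋖ z ∧ IsSibling h z w.1}.ncard : ℂ) := by
  classical
  rw [← sum_vertex_ite, Matrix.mul_apply]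
  refine Finset.sum_congr rfl fun z _ => ?_
  simp [raising, sibling, ← ite_and, and_comm]

theorem sibling_mul_transpose_apply (y w : Vertex h) :
    (sibling h * (raising h)ᵀ) y w =
      ({z : Submodule F H | z ⊓ h = ⊥ ∧ IsSibling h y.1 z ∧ z ⋖ w.1}.ncard : ℂ) := by
  classical
  rw [← sum_vertex_ite, Matrix.mul_apply]
  refine Finset.sum_congr rfl fun z _ => ?_
  simp [raising, sibling, ← ite_and, and_comm]

/-- In the lattice of all subspaces `R Rᵀ - Rᵀ R` is diagonal; siblings are the pairs whose sum has
left the poset. -/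
theorem raising_commutator {N M : ℕ} (hH : finrank F H = N + M) (hh : finrank F h = M) :
    raising h * (raising h)ᵀ - (raising h)ᵀ * raising h = updownDiagonal h N M + sibling h := by
  classical
  ext y w
  rw [Matrix.sub_apply, Matrix.add_apply, raising_mul_transpose_apply, transpose_mul_raising_apply]
  by_cases hyw : y = w
  · subst hyw
    have h1 : {z : Submodule F H | z ⊓ h = ⊥ ∧ z ⋖ y.1 ∧ z ⋖ y.1} = {z | z ⋖ y.1} := by
      ext z
      simp only [Set.mem_ofPred_eq, and_self, and_iff_right_iff_imp]
      exact fun hz => le_bot_iff.1 ((inf_le_inf_right h hz.le).trans y.2.le)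
    have h2 : {z : Submodule F H | z ⊓ h = ⊥ ∧ y.1 ⋖ z ∧ y.1 ⋖ z} =
        {z | z ⊓ h = ⊥ ∧ y.1 ⋖ z ∧ z ≤ ⊤} := by
      ext z
      simp
    have hdim : dim y ≤ N := Vertex.dim_le hH hh y
    rw [h1, h2, ncard_covBy_below, ncard_vertex_covBy_le y.2 le_top (k := N + M - dim y) (l := M)]
    · simp only [updownDiagonal, sibling, IsSibling, sup_idem, Matrix.diagonal_apply_eq,
        Matrix.of_apply, dim]
      simp
      ring
    · rw [finrank_top]
      unfold dim at *
      omega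
    · rw [top_inf_eq, finrank_sup_of_inf_eq_bot y.2, hh]
  · have hyw' : y.1 ≠ w.1 := fun h' => hyw (Subtype.ext h')
    rw [ncard_covered_by_both y.2 hyw', ncard_covers_both hyw' (fun z => z ⊓ h = ⊥)]
    simp only [updownDiagonal, sibling, Matrix.diagonal_apply_ne _ hyw, Matrix.of_apply]
    by_cases h1 : y.1 ⋖ y.1 ⊔ w.1 ∧ w.1 ⋖ y.1 ⊔ w.1
    · by_cases h2 : (y.1 ⊔ w.1) ⊓ h = ⊥ <;> simp [IsSibling, h1, h2]
    · rw [if_neg h1, if_neg h1, if_neg fun h' : IsSibling h y.1 w.1 => h1 ⟨h'.1, h'.2.1⟩]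
      simp

/-- Both sides are counted entrywise.  For `y ⋖ w`, the covers of `y` that are siblings of `w` are
the vertices other than `w` that cover `y` and lie in `w + h`.  Otherwise both products vanish at
`(y, w)` unless `y + w` covers `w` and meets `h`; in that case `q` siblings of `w` cover `y`, and
`w` covers exactly one sibling of `y`. -/
theorem transpose_mul_sibling {M : ℕ} (hh : finrank F h = M) :
    (raising h)ᵀ * sibling h = (Nat.card F : ℂ) • (sibling h * (raising h)ᵀ) +
      ((Nat.card F : ℂ) ^ M - 1) • (raising h)ᵀ := by
  classical
  have hfin : Finite H := Module.finite_of_finite F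
  have hq1 : (Nat.card F : ℂ) - 1 ≠ 0 := card_sub_one_ne_zero F
  ext y w
  rw [Matrix.add_apply, Matrix.smul_apply, Matrix.smul_apply, transpose_mul_sibling_apply,
    sibling_mul_transpose_apply]
  simp only [raising, Matrix.transpose_apply, Matrix.of_apply, smul_eq_mul]
  by_cases hyw : y.1 ⋖ w.1
  · have h0 : {z : Submodule F H | z ⊓ h = ⊥ ∧ IsSibling h y.1 z ∧ z ⋖ w.1} = ∅ := by
      ext z
      simp only [Set.mem_ofPred_eq, Set.mem_empty_iff_false, iff_false]
      rintro ⟨-, hs, hzw⟩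
      exact (sup_covBy_of_sibling_below w.2 hs hzw).1 hyw.le
    have hle : y.1 ⊔ h ≤ w.1 ⊔ h := sup_le_sup_right hyw.le h
    have hd := (covBy_iff_finrank.1 hyw).2
    have hy := finrank_sup_of_inf_eq_bot y.2
    have hw := finrank_sup_of_inf_eq_bot w.2
    have hc := ncard_vertex_covBy_le (t := w.1 ⊔ h) y.2 (hyw.le.trans le_sup_left) (k := M + 1)
      (l := M) (by omega) (by rw [inf_eq_right.2 hle]; omega)
    have hmem : w.1 ∈ {z : Submodule F H | z ⊓ h = ⊥ ∧ y.1 ⋖ z ∧ z ≤ w.1 ⊔ h} :=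
      ⟨w.2, hyw, le_sup_left⟩
    have hpos := (Set.ncard_pos (Set.toFinite _)).2 ⟨_, hmem⟩
    rw [siblings_above_of_covBy w.2 hyw, h0, Set.ncard_sdiff_singleton_of_mem hmem,
      Nat.cast_sub hpos, hc, if_pos hyw]
    field_simp
    simp
    ring
  · rw [if_neg hyw, mul_zero, add_zero]
    by_cases hB : ¬ y.1 ≤ w.1 ∧ finrank F w.1 = finrank F y.1 + 1 ∧ w.1 ⋖ y.1 ⊔ w.1 ∧
        (y.1 ⊔ w.1) ⊓ h ≠ ⊥
    · obtain ⟨hn, hd, hcov, hne⟩ := hB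
      have hd' := (covBy_iff_finrank.1 hcov).2
      rw [siblings_above_of_not_covBy hn hd hcov hne,
        siblings_below_of_not_covBy y.2 w.2 hn hd hcov hne,
        ncard_vertex_covBy_le (t := y.1 ⊔ w.1) y.2 le_sup_left (k := 2) (l := 1) (by omega)
          (finrank_inf_sup_of_sup_covBy y.2 w.2 hd hcov hne).1, Set.ncard_singleton]
      field_simp
      simp
    · have h0 : {z : Submodule F H | z ⊓ h = ⊥ ∧ IsSibling h y.1 z ∧ z ⋖ w.1} = ∅ := by
        ext z
        simp only [Set.mem_ofPred_eq, Set.mem_empty_iff_false, iff_false]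
        rintro ⟨-, hs, hzw⟩
        exact hB (sup_covBy_of_sibling_below w.2 hs hzw)
      have h1 : {z : Submodule F H | z ⊓ h = ⊥ ∧ y.1 ⋖ z ∧ IsSibling h z w.1} = ∅ := by
        ext z
        simp only [Set.mem_ofPred_eq, Set.mem_empty_iff_false, iff_false]
        rintro ⟨-, hyz, hs⟩
        exact hB (sup_covBy_of_sibling_above hyw hyz hs)
      rw [h0, h1]
      simp

end Vertices

/-! ### Relations between the raising, lowering and dual adjacency matrices -/

section Relations

variable {F H : Type*} [Field F] [AddCommGroup H] [Module F H] [Module.Finite F H] [Finite F]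
  {h : Submodule F H}

theorem card_ne_zero (F : Type*) [Field F] [Finite F] : (Nat.card F : ℂ) ≠ 0 := by
  exact_mod_cast (Nat.card_pos (α := F)).ne'

/-- The inverse of `A*`, with `(y, y)`-entry `q ^ dim y`. -/
noncomputable def dualMatrixInv (h : Submodule F H) : Matrix (Vertex h) (Vertex h) ℂ :=
  Matrix.diagonal fun y => (Nat.card F : ℂ) ^ dim y

theorem dualMatrix_mul_inv : dualMatrix h * dualMatrixInv h = 1 := by
  rw [dualMatrix, dualMatrixInv, Matrix.diagonal_mul_diagonal, ← Matrix.diagonal_one]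
  congr 1
  ext y
  rw [_root_.zpow_neg, zpow_natCast, inv_mul_cancel₀ (pow_ne_zero _ (card_ne_zero F))]

theorem inv_mul_dualMatrix : dualMatrixInv h * dualMatrix h = 1 := by
  rw [dualMatrix, dualMatrixInv, Matrix.diagonal_mul_diagonal, ← Matrix.diagonal_one]
  congr 1
  ext y
  rw [_root_.zpow_neg, zpow_natCast, mul_inv_cancel₀ (pow_ne_zero _ (card_ne_zero F))]

theorem qAdjMatrix_eq : qAdjMatrix h = raising h + dualMatrixInv h * (raising h)ᵀ := by
  classical
  ext y z
  rw [Matrix.add_apply, dualMatrixInv, Matrix.diagonal_mul]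
  simp only [qAdjMatrix, raising, Matrix.of_apply, Matrix.transpose_apply, Vertex.covBy_iff]
  by_cases h1 : z.1 ⋖ y.1
  · have h2 : ¬ y.1 ⋖ z.1 := fun h' => lt_asymm h1.lt h'.lt
    simp [h1, h2]
  · by_cases h2 : y.1 ⋖ z.1 <;> simp [h1, h2]

theorem raising_mul_dualMatrix :
    raising h * dualMatrix h = (Nat.card F : ℂ) • (dualMatrix h * raising h) := by
  classical
  ext y z
  rw [Matrix.smul_apply, dualMatrix, Matrix.mul_diagonal, Matrix.diagonal_mul, smul_eq_mul]
  simp only [raising, Matrix.of_apply]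
  split_ifs with h1
  · rw [Vertex.dim_eq_of_covBy (Vertex.covBy_iff.2 h1)]
    have := card_ne_zero F
    push_cast
    rw [neg_add, zpow_add₀ this, _root_.zpow_neg_one]
    field_simp
  · simp

theorem dualMatrix_mul_lowering :
    dualMatrix h * (raising h)ᵀ = (Nat.card F : ℂ) • ((raising h)ᵀ * dualMatrix h) := by
  have := congrArg Matrix.transpose (raising_mul_dualMatrix (h := h))
  rw [Matrix.transpose_smul, Matrix.transpose_mul, Matrix.transpose_mul] at this
  simpa only [dualMatrix, Matrix.diagonal_transpose] using this

/-- The weights `q` and `1` are chosen so that the sibling relation, which is not diagonal, drops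
out of `q (Rᵀ R - R Rᵀ) Rᵀ - Rᵀ (Rᵀ R - R Rᵀ)`; this is the uniform poset relation. -/
theorem uniform_lowering {N M : ℕ} (hH : finrank F H = N + M) (hh : finrank F h = M) :
    ((Nat.card F : ℂ) + 1) • ((raising h)ᵀ * (raising h * (raising h)ᵀ)) -
      (Nat.card F : ℂ) • (raising h * ((raising h)ᵀ * (raising h)ᵀ)) -
      (raising h)ᵀ * ((raising h)ᵀ * raising h) =
    (((Nat.card F : ℂ) + 1) * (Nat.card F : ℂ) ^ (N + M - 1)) •
      (dualMatrix h * (raising h)ᵀ) := by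
  classical
  have hC := raising_commutator hH hh
  have hS := transpose_mul_sibling hh
  set R := raising h
  set S := sibling h
  set D := updownDiagonal h N M with hD
  have hdiag : Rᵀ * D - (Nat.card F : ℂ) • (D * Rᵀ) + ((Nat.card F : ℂ) ^ M - 1) • Rᵀ =
      (((Nat.card F : ℂ) + 1) * (Nat.card F : ℂ) ^ (N + M - 1)) • (dualMatrix h * Rᵀ) := by
    ext y w
    rw [Matrix.add_apply, Matrix.sub_apply, Matrix.smul_apply, Matrix.smul_apply, Matrix.smul_apply,
      hD, updownDiagonal, dualMatrix, Matrix.mul_diagonal, Matrix.diagonal_mul, Matrix.diagonal_mul]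
    simp only [R, raising, Matrix.of_apply, Matrix.transpose_apply, smul_eq_mul]
    split_ifs with h1
    · have hw := Vertex.dim_eq_of_covBy (Vertex.covBy_iff.2 h1)
      have hN := Vertex.dim_le hH hh w
      obtain ⟨s, hs⟩ : ∃ s, N + M = dim y + 1 + s := ⟨N + M - (dim y + 1), by omega⟩
      have e1 : N + M - dim y = s + 1 := by omega
      have e2 : N + M - (dim y + 1) = s := by omega
      have e3 : N + M - 1 = dim y + s := by omega
      rw [hw, e1, e2, e3, _root_.zpow_neg, zpow_natCast]
      have := card_ne_zero F
      have := card_sub_one_ne_zero F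
      field_simp
      ring
    · simp
  rw [← hdiag]
  have e : Rᵀ * (R * Rᵀ) = Rᵀ * (Rᵀ * R) + Rᵀ * D + Rᵀ * S := by
    rw [← mul_add, ← mul_add, add_assoc, ← hC]
    congr 1
    abel
  have e' : R * (Rᵀ * Rᵀ) = Rᵀ * (R * Rᵀ) + D * Rᵀ + S * Rᵀ := by
    rw [← mul_assoc, ← mul_assoc, ← add_mul, ← add_mul, add_assoc, ← hC]
    congr 1
    abel
  rw [e', add_smul, one_smul]
  simp only [smul_add]
  rw [hS] at e
  linear_combination (norm := module) e

theorem uniform_raising {N M : ℕ} (hH : finrank F H = N + M) (hh : finrank F h = M) :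
    ((Nat.card F : ℂ) + 1) • (raising h * ((raising h)ᵀ * raising h)) -
      (Nat.card F : ℂ) • (raising h * (raising h * (raising h)ᵀ)) -
      (raising h)ᵀ * (raising h * raising h) =
    (((Nat.card F : ℂ) + 1) * (Nat.card F : ℂ) ^ (N + M - 1)) • (raising h * dualMatrix h) := by
  have := congrArg Matrix.transpose (uniform_lowering hH hh)
  simp only [Matrix.transpose_smul, Matrix.transpose_mul, Matrix.transpose_sub,
    Matrix.transpose_transpose, mul_assoc] at this
  rw [this, dualMatrix, Matrix.diagonal_transpose]

end Relations

/-! ### Consequences in an associative algebra -/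

section Algebra

variable {𝒜 : Type*} [Ring 𝒜] [Algebra ℂ 𝒜] {R L K Q : 𝒜} {q : ℂ}

/-- Here `K` and `Q` stand for `A*` and its inverse, and `R + Q L` for `A`. -/
theorem tridiagonal_expression (hq : q ≠ 0) (hRK : R * K = q • (K * R)) (hKL : K * L = q • (L * K))
    (hKQ : K * Q = 1) (hQK : Q * K = 1) :
    (R + Q * L) * (R + Q * L) * K - (q + q⁻¹) • ((R + Q * L) * K * (R + Q * L)) +
      K * ((R + Q * L) * (R + Q * L)) = (q - q⁻¹) • (q⁻¹ • (L * R) - R * L) := by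
  have hLK : L * K = q⁻¹ • (K * L) := by rw [hKL, smul_smul, inv_mul_cancel₀ hq, one_smul]
  have hRQ : R * Q = q⁻¹ • (Q * R) := by
    have : Q * (R * K) * Q = q • (Q * (K * R) * Q) := by rw [hRK]; simp
    rw [mul_assoc, mul_assoc, hKQ, mul_one, ← mul_assoc Q K, hQK, one_mul] at this
    rw [this, smul_smul, inv_mul_cancel₀ hq, one_smul]
  have hLQ : L * Q = q • (Q * L) := by
    have : Q * (K * L) * Q = q • (Q * (L * K) * Q) := by rw [hKL]; simp
    rw [mul_assoc Q (L * K), mul_assoc L, hKQ, mul_one, ← mul_assoc Q K, hQK, one_mul] at this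
    exact this
  have hRK' : ∀ x, R * (K * x) = q • (K * (R * x)) := fun x => by
    rw [← mul_assoc, hRK, smul_mul_assoc, mul_assoc]
  have hLK' : ∀ x, L * (K * x) = q⁻¹ • (K * (L * x)) := fun x => by
    rw [← mul_assoc, hLK, smul_mul_assoc, mul_assoc]
  have hRQ' : ∀ x, R * (Q * x) = q⁻¹ • (Q * (R * x)) := fun x => by
    rw [← mul_assoc, hRQ, smul_mul_assoc, mul_assoc]
  have hLQ' : ∀ x, L * (Q * x) = q • (Q * (L * x)) := fun x => by
    rw [← mul_assoc, hLQ, smul_mul_assoc, mul_assoc]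
  have hKQ' : ∀ x, K * (Q * x) = x := fun x => by rw [← mul_assoc, hKQ, one_mul]
  have hQK' : ∀ x, Q * (K * x) = x := fun x => by rw [← mul_assoc, hQK, one_mul]
  simp only [mul_add, add_mul, mul_assoc, hRK, hLK, hRK', hLK', hRQ', hLQ',
    hKQ', hQK', smul_mul_assoc, mul_smul_comm, smul_smul]
  match_scalars <;> field_simp <;> ring

/-- The element that measures the failure of the `q`-Serre relation between `A` and `A*` is
central in the subalgebra generated by `R`, `Rᵀ` and `A*`. -/
theorem casimir_commute (hq : q ≠ 0) {c : ℂ} (hRK : R * K = q • (K * R))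
    (hKL : K * L = q • (L * K)) (hKQ : K * Q = 1) (hQK : Q * K = 1)
    (hU : (q + 1) • (L * (R * L)) - q • (R * (L * L)) - L * (L * R) = ((q + 1) * c) • (K * L))
    (hU' : (q + 1) • (R * (L * R)) - q • (R * (R * L)) - L * (R * R) = ((q + 1) * c) • (R * K)) :
    Commute (R + Q * L) ((q - q⁻¹) • (q⁻¹ • (L * R) - R * L) - ((q + 1) ^ 2 * q⁻¹ * c) • K) := by
  have hLK : L * K = q⁻¹ • (K * L) := by rw [hKL, smul_smul, inv_mul_cancel₀ hq, one_smul]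
  have hKR : K * R = q⁻¹ • (R * K) := by rw [hRK, smul_smul, inv_mul_cancel₀ hq, one_smul]
  have hRQ : R * Q = q⁻¹ • (Q * R) := by
    have : Q * (R * K) * Q = q • (Q * (K * R) * Q) := by rw [hRK]; simp
    rw [mul_assoc, mul_assoc, hKQ, mul_one, ← mul_assoc Q K, hQK, one_mul] at this
    rw [this, smul_smul, inv_mul_cancel₀ hq, one_smul]
  have hLQ : L * Q = q • (Q * L) := by
    have : Q * (K * L) * Q = q • (Q * (L * K) * Q) := by rw [hKL]; simp
    rw [mul_assoc Q (L * K), mul_assoc L, hKQ, mul_one, ← mul_assoc Q K, hQK, one_mul] at this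
    exact this
  set W := (q - q⁻¹) • (q⁻¹ • (L * R) - R * L) - ((q + 1) ^ 2 * q⁻¹ * c) • K with hW
  have hWR : Commute R W := by
    have e : R * W - W * R = ((q - q⁻¹) * q⁻¹) • ((q + 1) • (R * (L * R)) - q • (R * (R * L)) -
        L * (R * R) - ((q + 1) * c) • (R * K)) := by
      simp only [hW, mul_sub, sub_mul, mul_smul_comm, smul_mul_assoc, mul_assoc, hKR, smul_sub,
        smul_smul]
      match_scalars <;> field_simp <;> ring
    rwa [hU', sub_self, smul_zero, sub_eq_zero] at e
  have hWL : Commute L W := by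
    have e : L * W - W * L = (-(q - q⁻¹) * q⁻¹) • ((q + 1) • (L * (R * L)) - q • (R * (L * L)) -
        L * (L * R) - ((q + 1) * c) • (K * L)) := by
      simp only [hW, mul_sub, sub_mul, mul_smul_comm, smul_mul_assoc, mul_assoc, hLK, smul_sub,
        smul_smul]
      match_scalars <;> field_simp <;> ring
    rwa [hU, sub_self, smul_zero, sub_eq_zero] at e
  have hWQ : Commute Q W := by
    have hRQ' : ∀ x, R * (Q * x) = q⁻¹ • (Q * (R * x)) := fun x => by
      rw [← mul_assoc, hRQ, smul_mul_assoc, mul_assoc]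
    have hLQ' : ∀ x, L * (Q * x) = q • (Q * (L * x)) := fun x => by
      rw [← mul_assoc, hLQ, smul_mul_assoc, mul_assoc]
    unfold Commute SemiconjBy
    simp only [hW, mul_sub, sub_mul, mul_smul_comm, smul_mul_assoc, mul_assoc, hRQ, hLQ, hRQ',
      hLQ', hKQ, hQK, smul_sub, smul_smul, mul_inv_cancel₀ hq, inv_mul_cancel₀ hq, mul_one]
  exact hWR.add_left (hWQ.mul_left hWL)

end Algebra

/-! ### The polynomials attached to a ladder -/

section Krawtchouk

open Polynomial

/-- The polynomial `∏_{k<j} (1 - q^k X) ∏_{k<l} (1 + q^k X)`, whose coefficients are the entries of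
an eigenvector of `A` along a ladder. -/
noncomputable def ladderPolynomial (q : ℂ) (j l : ℕ) : ℂ[X] :=
  (∏ k ∈ Finset.range j, (1 - C (q ^ k) * X)) * ∏ k ∈ Finset.range l, (1 + C (q ^ k) * X)

variable {q : ℂ} {j l : ℕ}

theorem ladderPolynomial_coeff_zero : (ladderPolynomial q j l).coeff 0 = 1 := by
  simp [ladderPolynomial, coeff_zero_eq_eval_zero, eval_prod]

theorem ladderPolynomial_natDegree_le : (ladderPolynomial q j l).natDegree ≤ j + l := by
  refine natDegree_mul_le_of_le ?_ ?_
  · refine (natDegree_prod_le _ _).trans ?_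
    refine (Finset.sum_le_card_nsmul _ _ 1 fun k _ => ?_).trans (by simp)
    compute_degree
  · refine (natDegree_prod_le _ _).trans ?_
    refine (Finset.sum_le_card_nsmul _ _ 1 fun k _ => ?_).trans (by simp)
    compute_degree

theorem ladderPolynomial_functional_equation :
    (1 - X ^ 2) * (ladderPolynomial q j l).comp (C q * X) =
      (1 + C (q ^ l - q ^ j) * X - C (q ^ (j + l)) * X ^ 2) * ladderPolynomial q j l := by
  have h1 : (∏ k ∈ Finset.range j, (1 - C (q ^ k) * X)).comp (C q * X) * (1 - X) =
      (∏ k ∈ Finset.range j, (1 - C (q ^ k) * X)) * (1 - C (q ^ j) * X) := by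
    rw [← Finset.prod_range_succ, Finset.prod_range_succ', prod_comp]
    simp [pow_succ, mul_assoc]
  have h2 : (∏ k ∈ Finset.range l, (1 + C (q ^ k) * X)).comp (C q * X) * (1 + X) =
      (∏ k ∈ Finset.range l, (1 + C (q ^ k) * X)) * (1 + C (q ^ l) * X) := by
    rw [← Finset.prod_range_succ, Finset.prod_range_succ', prod_comp]
    simp [pow_succ, mul_assoc]
  rw [ladderPolynomial, mul_comp, C_sub, pow_add, C_mul]
  linear_combination h1 * (∏ k ∈ Finset.range l, (1 + C (q ^ k) * X)).comp (C q * X) * (1 + X) +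
    (∏ k ∈ Finset.range j, (1 - C (q ^ k) * X)) * (1 - C (q ^ j) * X) * h2

theorem ladderPolynomial_coeff_one :
    (q - 1) * (ladderPolynomial q j l).coeff 1 =
      (q ^ l - q ^ j) * (ladderPolynomial q j l).coeff 0 := by
  have h := congrArg (coeff · 1) (ladderPolynomial_functional_equation (q := q) (j := j) (l := l))
  simp only [sub_mul, add_mul, one_mul, coeff_sub, coeff_add, mul_assoc, coeff_C_mul,
    coeff_X_pow_mul', comp_C_mul_X_coeff, coeff_X_mul] at h
  norm_num at h
  linear_combination h

theorem ladderPolynomial_coeff_succ (i : ℕ) :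
    (q ^ (i + 2) - 1) * (ladderPolynomial q j l).coeff (i + 2) +
      (q ^ (j + l) - q ^ i) * (ladderPolynomial q j l).coeff i =
      (q ^ l - q ^ j) * (ladderPolynomial q j l).coeff (i + 1) := by
  have h := congrArg (coeff · (i + 2))
    (ladderPolynomial_functional_equation (q := q) (j := j) (l := l))
  simp only [sub_mul, add_mul, one_mul, coeff_sub, coeff_add, mul_assoc, coeff_C_mul,
    coeff_X_pow_mul, comp_C_mul_X_coeff, coeff_X_mul] at h
  linear_combination h

end Krawtchouk

/-! ### Eigenvectors on an abstract ladder -/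

section Ladder

variable {V : Type*} [AddCommGroup V] [Module ℂ V] {A : End ℂ V} {v : ℕ → V} {q γ : ℂ} {d : ℕ}

/-- The coefficient, relative to the ladder vector `v i`, by which the monomial `X ^ i` has to be
rescaled for `A` to act as a `q`-difference operator. -/
noncomputable def ladderWeight (q γ : ℂ) (d i : ℕ) : ℂ :=
  (γ ^ i * ∏ k ∈ Finset.range i, (q ^ d - q ^ k))⁻¹

theorem ladderWeight_succ (hq : ∀ n : ℕ, 0 < n → q ^ n ≠ 1) (hq0 : q ≠ 0) (hγ : γ ≠ 0) {i : ℕ}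
    (hi : i < d) : γ * (q ^ d - q ^ i) * ladderWeight q γ d (i + 1) = ladderWeight q γ d i := by
  have h : q ^ d - q ^ i ≠ 0 := by
    obtain ⟨s, rfl⟩ := Nat.exists_eq_add_of_lt hi
    have := hq (s + 1) (by omega)
    rw [add_assoc, pow_add, ← mul_sub_one]
    exact mul_ne_zero (pow_ne_zero _ hq0) (sub_ne_zero.2 this)
  rw [ladderWeight, ladderWeight, Finset.prod_range_succ, pow_succ]
  rw [show γ ^ i * γ * ((∏ k ∈ Finset.range i, (q ^ d - q ^ k)) * (q ^ d - q ^ i)) =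
    γ * (q ^ d - q ^ i) * (γ ^ i * ∏ k ∈ Finset.range i, (q ^ d - q ^ k)) by ring, mul_inv,
    ← mul_assoc, mul_inv_cancel₀ (mul_ne_zero hγ h), one_mul]

/-- The combination of the ladder vectors `v 0, …, v d` with the rescaled coefficients of
`ladderPolynomial q j (d - j)`; it is an eigenvector of `A`. -/
noncomputable def ladderEigenvector (v : ℕ → V) (q γ : ℂ) (d j : ℕ) : V :=
  ∑ i ∈ Finset.range (d + 1),
    ((ladderPolynomial q j (d - j)).coeff i * ladderWeight q γ d i) • v i

theorem apply_ladderEigenvector (hq : ∀ n : ℕ, 0 < n → q ^ n ≠ 1) (hq0 : q ≠ 0) (hγ : γ ≠ 0)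
    (h0 : A (v 0) = v 1) (hd : v (d + 1) = 0)
    (hA : ∀ i < d, A (v (i + 1)) =
      v (i + 2) + (γ ^ 2 * (q ^ (i + 1) - 1) * (q ^ d - q ^ i)) • v i)
    {j : ℕ} (hj : j ≤ d) :
    A (ladderEigenvector v q γ d j) =
      (γ * (q ^ (d - j) - q ^ j)) • ladderEigenvector v q γ d j := by
  obtain ⟨l, rfl⟩ := Nat.exists_eq_add_of_le hj
  rw [ladderEigenvector, Nat.add_sub_cancel_left]
  set a := (ladderPolynomial q j l).coeff with ha
  set d := j + l with hdd
  have had : a (d + 1) = 0 := Polynomial.coeff_eq_zero_of_natDegree_lt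
    (Nat.lt_succ_of_le ladderPolynomial_natDegree_le)
  set w := ladderWeight q γ d with hw
  have hws : ∀ i < d, γ * (q ^ d - q ^ i) * w (i + 1) = w i :=
    fun i hi => ladderWeight_succ hq hq0 hγ hi
  have hup : ∑ i ∈ Finset.range (d + 1), (a i * w i) • v (i + 1) =
      ∑ i ∈ Finset.range d, (γ * (q ^ d - q ^ i) * a i * w (i + 1)) • v (i + 1) := by
    rw [Finset.sum_range_succ, hd, smul_zero, add_zero]
    refine Finset.sum_congr rfl fun i hi => ?_
    rw [← hws i (Finset.mem_range.1 hi)]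
    congr 1
    ring
  have hdown : ∑ i ∈ Finset.range d,
      (a (i + 1) * w (i + 1)) • ((γ ^ 2 * (q ^ (i + 1) - 1) * (q ^ d - q ^ i)) • v i) =
      ∑ i ∈ Finset.range (d + 1), (γ * (q ^ (i + 1) - 1) * a (i + 1) * w i) • v i := by
    rw [Finset.sum_range_succ, had, mul_zero, zero_mul, zero_smul, add_zero]
    refine Finset.sum_congr rfl fun i hi => ?_
    rw [← hws i (Finset.mem_range.1 hi), smul_smul]
    congr 1
    ring
  have hsplit : A (∑ i ∈ Finset.range (d + 1), (a i * w i) • v i) =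
      (∑ i ∈ Finset.range (d + 1), (a i * w i) • v (i + 1)) + ∑ i ∈ Finset.range d,
      (a (i + 1) * w (i + 1)) • ((γ ^ 2 * (q ^ (i + 1) - 1) * (q ^ d - q ^ i)) • v i) := by
    rw [map_sum, Finset.sum_range_succ', Finset.sum_range_succ' (fun i => (a i * w i) • v (i + 1)),
      add_right_comm, ← Finset.sum_add_distrib, map_smul, h0]
    congr 1
    refine Finset.sum_congr rfl fun i hi => ?_
    rw [map_smul, hA i (Finset.mem_range.1 hi), smul_add]
  rw [hsplit, hup, hdown, Finset.sum_range_succ', Finset.smul_sum, Finset.sum_range_succ',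
    ← add_assoc, ← Finset.sum_add_distrib]
  congr 1
  · refine Finset.sum_congr rfl fun i _ => ?_
    rw [← add_smul, smul_smul]
    congr 1
    linear_combination γ * w (i + 1) * ladderPolynomial_coeff_succ (q := q) (j := j) (l := l) i
  · rw [smul_smul, zero_add, pow_one]
    congr 1
    linear_combination γ * w 0 * ladderPolynomial_coeff_one (q := q) (j := j) (l := l)

theorem ladderEigenvector_ne_zero (hv : LinearIndependent ℂ fun i : Fin (d + 1) => v i) (j : ℕ) :
    ladderEigenvector v q γ d j ≠ 0 := by
  intro h
  rw [ladderEigenvector, Finset.sum_range] at h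
  have := Fintype.linearIndependent_iff.1 hv _ h 0
  simp [ladderPolynomial_coeff_zero, ladderWeight] at this

/-- The `d + 1` eigenvectors of `A` found in a ladder of length `d + 1` have distinct eigenvalues,
hence span the ladder. -/
theorem ladder_mem_iSup_eigenspace (hq : ∀ n : ℕ, 0 < n → q ^ n ≠ 1) (hq0 : q ≠ 0) (hγ : γ ≠ 0)
    (hinj : ∀ i ≤ d, ∀ j ≤ d, q ^ (d - i) - q ^ i = q ^ (d - j) - q ^ j → i = j)
    (h0 : A (v 0) = v 1) (hd : v (d + 1) = 0)
    (hA : ∀ i < d, A (v (i + 1)) =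
      v (i + 2) + (γ ^ 2 * (q ^ (i + 1) - 1) * (q ^ d - q ^ i)) • v i)
    (hv : LinearIndependent ℂ fun i : Fin (d + 1) => v i) {i : ℕ} (hi : i ≤ d) :
    v i ∈ ⨆ j : Fin (d + 1), End.eigenspace A (γ * (q ^ (d - (j : ℕ)) - q ^ (j : ℕ))) := by
  have heig : ∀ j : Fin (d + 1), A.HasEigenvector (γ * (q ^ (d - (j : ℕ)) - q ^ (j : ℕ)))
      (ladderEigenvector v q γ d j) := fun j =>
    ⟨End.mem_eigenspace_iff.2
      (apply_ladderEigenvector hq hq0 hγ h0 hd hA (Nat.lt_succ_iff.1 j.2)),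
      ladderEigenvector_ne_zero hv j⟩
  have hli : LinearIndependent ℂ fun j : Fin (d + 1) => ladderEigenvector v q γ d j :=
    End.eigenvectors_linearIndependent' A _ (fun i j hij => Fin.ext <|
      hinj _ (Nat.lt_succ_iff.1 i.2) _ (Nat.lt_succ_iff.1 j.2) (mul_left_cancel₀ hγ hij)) _ heig
  have hle : Submodule.span ℂ (Set.range fun j : Fin (d + 1) => ladderEigenvector v q γ d j) ≤
      Submodule.span ℂ (Set.range fun i : Fin (d + 1) => v i) := by
    rw [Submodule.span_le]
    rintro _ ⟨j, rfl⟩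
    refine Submodule.sum_mem _ fun i hi => Submodule.smul_mem _ _ (Submodule.subset_span ?_)
    exact ⟨⟨i, Finset.mem_range.1 hi⟩, rfl⟩
  have := FiniteDimensional.span_of_finite ℂ (Set.finite_range fun i : Fin (d + 1) => v i)
  have heq := Submodule.eq_of_le_of_finrank_eq hle (by
    rw [finrank_span_eq_card hli, finrank_span_eq_card hv])
  have hvi : v i ∈ Submodule.span ℂ (Set.range fun i : Fin (d + 1) => v i) :=
    Submodule.subset_span ⟨⟨i, Nat.lt_succ_iff.2 hi⟩, rfl⟩
  rw [← heq] at hvi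
  refine Submodule.span_le.2 ?_ hvi
  rintro _ ⟨j, rfl⟩
  exact Submodule.mem_iSup_of_mem j (heig j).1

end Ladder

/-! ### The scalars `θ_i` -/

section Theta

theorem theta_strictAnti {q : ℕ} (hq : 1 < q) (N M : ℕ) : StrictAnti (theta q N M) := by
  intro i j hij
  have hq' : (1 : ℝ) < q := by exact_mod_cast hq
  have hij' : (i : ℝ) < j := by exact_mod_cast hij
  have h1 : (q : ℝ) ^ ((N : ℝ) - j) < (q : ℝ) ^ ((N : ℝ) - i) :=
    Real.rpow_lt_rpow_of_exponent_lt hq' (by linarith)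
  have h2 : (q : ℝ) ^ (i : ℝ) < (q : ℝ) ^ (j : ℝ) := Real.rpow_lt_rpow_of_exponent_lt hq' hij'
  unfold theta
  have : 0 < (q : ℝ) - 1 := by linarith
  gcongr

/-- The scale factor `q ^ ((N + M - d) / 2) / (q - 1)` of the eigenvalues of `A` on a ladder of
length `d + 1`. -/
noncomputable def ladderScale (q N M d : ℕ) : ℝ :=
  (q : ℝ) ^ (((N : ℝ) + M - d) / 2) / ((q : ℝ) - 1)

theorem ladderScale_pos {q : ℕ} (hq : 1 < q) (N M d : ℕ) : 0 < ladderScale q N M d := by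
  have hq' : (1 : ℝ) < q := by exact_mod_cast hq
  exact div_pos (Real.rpow_pos_of_pos (by linarith) _) (by linarith)

theorem ladderScale_sq {q : ℕ} (hq : 1 < q) (N M d : ℕ) :
    ladderScale q N M d ^ 2 * ((q : ℝ) - 1) ^ 2 * (q : ℝ) ^ d = (q : ℝ) ^ (N + M) := by
  have hq' : (1 : ℝ) < q := by exact_mod_cast hq
  have hq0 : (0 : ℝ) < q := by linarith
  have hne : (q : ℝ) - 1 ≠ 0 := by linarith
  rw [ladderScale, div_pow, div_mul_cancel₀ _ (pow_ne_zero 2 hne), ← Real.rpow_natCast,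
    ← Real.rpow_natCast, ← Real.rpow_natCast, ← Real.rpow_mul hq0.le, ← Real.rpow_add hq0]
  congr 1
  push_cast
  ring

theorem theta_eq_ladderScale {q : ℕ} (hq : 1 < q) {N d j : ℕ} (M : ℕ) (hd : d ≤ N) (hj : j ≤ d) :
    theta q N M (((N - d + 2 * j : ℕ) : ℚ) / 2) =
      ladderScale q N M d * ((q : ℝ) ^ (d - j) - (q : ℝ) ^ j) := by
  have hq' : (1 : ℝ) < q := by exact_mod_cast hq
  have hq0 : (0 : ℝ) < q := by linarith
  unfold theta ladderScale
  rw [div_mul_eq_mul_div, div_mul_eq_mul_div, sub_mul, mul_sub, ← Real.rpow_natCast,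
    ← Real.rpow_natCast, ← Real.rpow_add hq0, ← Real.rpow_add hq0, ← Real.rpow_add hq0,
    ← Real.rpow_add hq0]
  push_cast [Nat.cast_sub hd, Nat.cast_sub hj]
  congr 3 <;> ring

end Theta

/-! ### Ladders in the standard module -/

section Ladder

variable {F H : Type*} [Field F] [AddCommGroup H] [Module F H] [Module.Finite F H] [Finite F]
  {h : Submodule F H}

/-- A vector is homogeneous of degree `r` if it is supported on the vertices of dimension `r`. -/
def IsHomogeneous (h : Submodule F H) (v : Vertex h → ℂ) (r : ℕ) : Prop :=
  ∀ y, v y ≠ 0 → dim y = r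

theorem IsHomogeneous.raising {v : Vertex h → ℂ} {r : ℕ} (hv : IsHomogeneous h v r) :
    IsHomogeneous h (raising h *ᵥ v) (r + 1) := by
  intro y hy
  obtain ⟨z, -, hz⟩ := Finset.exists_ne_zero_of_sum_ne_zero hy
  have h1 := hv z (right_ne_zero_of_mul hz)
  have h2 : z.1 ⋖ y.1 := by
    by_contra h3
    exact left_ne_zero_of_mul hz (if_neg h3)
  rw [Vertex.dim_eq_of_covBy (Vertex.covBy_iff.2 h2), h1]

theorem IsHomogeneous.lowering {v : Vertex h → ℂ} {r : ℕ} (hv : IsHomogeneous h v r) (y : Vertex h)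
    (hy : ((AttenuatedSpace.raising h)ᵀ *ᵥ v) y ≠ 0) : r = dim y + 1 := by
  obtain ⟨z, -, hz⟩ := Finset.exists_ne_zero_of_sum_ne_zero hy
  have h1 := hv z (right_ne_zero_of_mul hz)
  have h2 : y.1 ⋖ z.1 := by
    by_contra h3
    exact left_ne_zero_of_mul hz (if_neg h3)
  rw [← h1, Vertex.dim_eq_of_covBy (Vertex.covBy_iff.2 h2)]

theorem IsHomogeneous.dualMatrix_mulVec {v : Vertex h → ℂ} {r : ℕ} (hv : IsHomogeneous h v r) :
    dualMatrix h *ᵥ v = ((Nat.card F : ℂ) ^ r)⁻¹ • v := by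
  ext y
  rw [dualMatrix, Matrix.mulVec_diagonal, Pi.smul_apply, smul_eq_mul]
  by_cases hy : v y = 0
  · simp [hy]
  · rw [hv y hy, _root_.zpow_neg, zpow_natCast]

theorem IsHomogeneous.dualMatrixInv_mulVec {v : Vertex h → ℂ} {r : ℕ} (hv : IsHomogeneous h v r) :
    dualMatrixInv h *ᵥ v = (Nat.card F : ℂ) ^ r • v := by
  ext y
  rw [dualMatrixInv, Matrix.mulVec_diagonal, Pi.smul_apply, smul_eq_mul]
  by_cases hy : v y = 0
  · simp [hy]
  · rw [hv y hy]

/-- A lowest weight vector: homogeneous of degree `r`, killed by the lowering matrix, and an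
eigenvector of `Rᵀ R` for `c` (or zero). -/
structure IsLadderBase (h : Submodule F H) (v : Vertex h → ℂ) (r : ℕ) (c : ℂ) : Prop where
  homogeneous : IsHomogeneous h v r
  lowering_eq_zero : (raising h)ᵀ *ᵥ v = 0
  lowering_raising : (raising h)ᵀ *ᵥ (raising h *ᵥ v) = c • v

/-- The ladder `v, R v, R² v, …`. -/
noncomputable def ladder (h : Submodule F H) (v : Vertex h → ℂ) (i : ℕ) : Vertex h → ℂ :=
  raising h ^ i *ᵥ v

variable {v : Vertex h → ℂ} {r : ℕ} {c : ℂ}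

theorem ladder_zero : ladder h v 0 = v := by simp [ladder]

theorem ladder_succ (i : ℕ) : ladder h v (i + 1) = raising h *ᵥ ladder h v i := by
  rw [ladder, ladder, pow_succ', Matrix.mulVec_mulVec]

theorem ladder_eq_zero_of_le {i j : ℕ} (hi : ladder h v i = 0) (hij : i ≤ j) :
    ladder h v j = 0 := by
  induction j, hij using Nat.le_induction with
  | base => exact hi
  | succ j _ ih => rw [ladder_succ, ih, Matrix.mulVec_zero]

theorem IsHomogeneous.ladder (hv : IsHomogeneous h v r) (i : ℕ) :
    IsHomogeneous h (ladder h v i) (r + i) := by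
  induction i with
  | zero => rwa [ladder_zero]
  | succ i ih => rw [ladder_succ]; exact ih.raising

theorem ladder_eq_zero {N M : ℕ} (hH : finrank F H = N + M) (hh : finrank F h = M)
    (hv : IsHomogeneous h v r) {i : ℕ} (hi : N < r + i) : ladder h v i = 0 := by
  ext y
  by_contra hy
  have h1 := hv.ladder i y hy
  have h2 := Vertex.dim_le hH hh y
  omega

/-- The constant `q ^ (N + M + 1 - r) / (q - 1) ^ 2`. -/
noncomputable def ladderConst (F : Type*) (N M r : ℕ) : ℂ :=
  (Nat.card F : ℂ) ^ (N + M + 1) / ((Nat.card F : ℂ) ^ r * ((Nat.card F : ℂ) - 1) ^ 2)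

/-- The scalar by which `Rᵀ` takes the `i`-th vector of a ladder to the previous one; it solves the
linear recurrence imposed by `uniform_raising`. -/
noncomputable def ladderCoeff (F : Type*) (N M r : ℕ) (c : ℂ) (i : ℕ) : ℂ :=
  ((Nat.card F : ℂ) ^ i - 1) * (ladderConst F N M r / (Nat.card F : ℂ) ^ i -
    (ladderConst F N M r / Nat.card F - c / ((Nat.card F : ℂ) - 1)))

theorem lowering_ladder {N M : ℕ} (hM : 0 < M) (hH : finrank F H = N + M) (hh : finrank F h = M)
    (hv : IsLadderBase h v r c) (i : ℕ) :
    (raising h)ᵀ *ᵥ ladder h v (i + 1) = ladderCoeff F N M r c (i + 1) • ladder h v i := by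
  have hq := card_ne_zero F
  have hq1 := card_sub_one_ne_zero F
  have key : ∀ i, (raising h)ᵀ *ᵥ ladder h v (i + 2) =
      ((Nat.card F : ℂ) + 1) • (raising h *ᵥ ((raising h)ᵀ *ᵥ ladder h v (i + 1))) -
      (Nat.card F : ℂ) • (raising h *ᵥ (raising h *ᵥ ((raising h)ᵀ *ᵥ ladder h v i))) -
      (((Nat.card F : ℂ) + 1) * (Nat.card F : ℂ) ^ (N + M - 1) *
        ((Nat.card F : ℂ) ^ (r + i))⁻¹) • ladder h v (i + 1) := by
    intro i
    have := congrArg (· *ᵥ ladder h v i) (uniform_raising hH hh)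
    simp only [Matrix.sub_mulVec, Matrix.smul_mulVec, ← Matrix.mulVec_mulVec, ← ladder_succ,
      (hv.homogeneous.ladder i).dualMatrix_mulVec, Matrix.mulVec_smul, smul_smul] at this
    rw [← this]
    module
  obtain ⟨s, hs⟩ : ∃ s, N + M = s + 1 := ⟨N + M - 1, by omega⟩
  rw [hs, Nat.add_sub_cancel] at key
  have h1 : (raising h)ᵀ *ᵥ ladder h v 1 = ladderCoeff F N M r c 1 • ladder h v 0 := by
    rw [ladder_succ, ladder_zero, hv.lowering_raising, ladderCoeff]
    congr 1
    field_simp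
    ring
  induction i using Nat.twoStepInduction with
  | zero => exact h1
  | one =>
    have hl : (raising h)ᵀ *ᵥ ladder h v 0 = 0 := by rw [ladder_zero, hv.lowering_eq_zero]
    rw [key 0, h1, hl, Matrix.mulVec_smul, ← ladder_succ, Matrix.mulVec_zero, Matrix.mulVec_zero,
      smul_zero, sub_zero, smul_smul, ← sub_smul]
    congr 1
    simp only [ladderCoeff, ladderConst, hs]
    field_simp
    ring
  | more i ih1 ih2 =>
    rw [key (i + 1), ih2, ih1, Matrix.mulVec_smul, Matrix.mulVec_smul, Matrix.mulVec_smul,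
      ← ladder_succ, ← ladder_succ, ← ladder_succ, smul_smul, smul_smul, ← sub_smul, ← sub_smul]
    congr 1
    simp only [ladderCoeff, ladderConst, hs]
    field_simp
    ring

theorem qAdjMatrix_ladder_zero (hv : IsLadderBase h v r c) :
    qAdjMatrix h *ᵥ ladder h v 0 = ladder h v 1 := by
  rw [qAdjMatrix_eq, Matrix.add_mulVec, ← Matrix.mulVec_mulVec, ladder_succ, ladder_zero,
    hv.lowering_eq_zero, Matrix.mulVec_zero, add_zero]

/-- The end of the ladder determines `c`, and with it the action of `A` on the ladder. -/
theorem qAdjMatrix_ladder_succ {N M d : ℕ} (hM : 0 < M) (hH : finrank F H = N + M)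
    (hh : finrank F h = M) (hv : IsLadderBase h v r c) (hd : ladder h v d ≠ 0)
    (hd1 : ladder h v (d + 1) = 0) (i : ℕ) :
    qAdjMatrix h *ᵥ ladder h v (i + 1) = ladder h v (i + 2) +
      (((ladderScale (Nat.card F) N M d : ℝ) : ℂ) ^ 2 * ((Nat.card F : ℂ) ^ (i + 1) - 1) *
        ((Nat.card F : ℂ) ^ d - (Nat.card F : ℂ) ^ i)) • ladder h v i := by
  have hq := card_ne_zero F
  have hq1 := card_sub_one_ne_zero F
  have hcard : 1 < Nat.card F := Finite.one_lt_card
  have hscale : ((ladderScale (Nat.card F) N M d : ℝ) : ℂ) ^ 2 =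
      (Nat.card F : ℂ) ^ (N + M) / (((Nat.card F : ℂ) - 1) ^ 2 * (Nat.card F : ℂ) ^ d) := by
    rw [eq_div_iff (mul_ne_zero (pow_ne_zero _ hq1) (pow_ne_zero _ hq)), ← mul_assoc]
    exact_mod_cast congrArg (Complex.ofReal) (ladderScale_sq hcard N M d)
  -- `Rᵀ` kills `R ^ (d + 1) v = 0` but not `R ^ d v`, so the coefficient linking them is zero.
  have htop : ladderConst F N M r / Nat.card F - c / ((Nat.card F : ℂ) - 1) =
      ladderConst F N M r / (Nat.card F : ℂ) ^ (d + 1) := by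
    have h1 := lowering_ladder hM hH hh hv d
    rw [hd1, Matrix.mulVec_zero, eq_comm, smul_eq_zero_iff_left hd, ladderCoeff] at h1
    have h2 : (Nat.card F : ℂ) ^ (d + 1) - 1 ≠ 0 := by
      rw [sub_ne_zero]
      exact_mod_cast (Nat.one_lt_pow (by omega) hcard).ne'
    exact (sub_eq_zero.1 ((mul_eq_zero.1 h1).resolve_left h2)).symm
  rw [qAdjMatrix_eq, Matrix.add_mulVec, ← Matrix.mulVec_mulVec, ← ladder_succ,
    lowering_ladder hM hH hh hv, Matrix.mulVec_smul,
    (hv.homogeneous.ladder i).dualMatrixInv_mulVec, smul_smul, hscale, ladderCoeff, htop,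
    ladderConst]
  congr 2
  field_simp
  ring

theorem linearIndependent_ladder {d : ℕ} (hv : IsHomogeneous h v r) (hd : ladder h v d ≠ 0) :
    LinearIndependent ℂ fun i : Fin (d + 1) => ladder h v i := by
  have hne : ∀ i ≤ d, ladder h v i ≠ 0 := fun i hi h0 => hd (ladder_eq_zero_of_le h0 hi)
  rw [Fintype.linearIndependent_iff]
  intro g hg i
  obtain ⟨y, hy⟩ := Function.ne_iff.1 (hne i (Nat.lt_succ_iff.1 i.2))
  have h1 := congrFun hg y
  rw [Finset.sum_apply, Finset.sum_eq_single i] at h1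
  · exact (mul_eq_zero.1 h1).resolve_right hy
  · intro j _ hji
    by_contra h2
    have h3 := hv.ladder j y (right_ne_zero_of_mul h2)
    have h4 := hv.ladder i y hy
    exact hji (Fin.ext (by omega))
  · simp

theorem pow_sub_pow_injective {q : ℕ} (hq : 1 < q) {d i j : ℕ} (hi : i ≤ d) (hj : j ≤ d)
    (hij : (q : ℂ) ^ (d - i) - (q : ℂ) ^ i = (q : ℂ) ^ (d - j) - (q : ℂ) ^ j) : i = j := by
  have h1 : (q : ℂ) ^ (d - i) + (q : ℂ) ^ j = (q : ℂ) ^ (d - j) + (q : ℂ) ^ i := by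
    linear_combination hij
  have h2 : q ^ (d - i) + q ^ j = q ^ (d - j) + q ^ i := by exact_mod_cast h1
  rcases lt_trichotomy i j with h3 | h3 | h3
  · have h4 := Nat.pow_lt_pow_right hq h3
    have h5 := Nat.pow_lt_pow_right hq (show d - j < d - i by omega)
    omega
  · exact h3
  · have h4 := Nat.pow_lt_pow_right hq h3
    have h5 := Nat.pow_lt_pow_right hq (show d - i < d - j by omega)
    omega

theorem card_pow_ne_one (F : Type*) [Field F] [Finite F] (n : ℕ) (hn : 0 < n) :
    (Nat.card F : ℂ) ^ n ≠ 1 := by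
  exact_mod_cast (Nat.one_lt_pow hn.ne' (Finite.one_lt_card (α := F))).ne'

theorem eigenspaceA_eq_ladderScale {N M d j : ℕ} (hd : d ≤ N) (hj : j ≤ d) :
    eigenspaceA h N M (((N - d + 2 * j : ℕ) : ℚ) / 2) =
      End.eigenspace (qAdjMatrix h).mulVecLin (((ladderScale (Nat.card F) N M d : ℝ) : ℂ) *
        ((Nat.card F : ℂ) ^ (d - j) - (Nat.card F : ℂ) ^ j)) := by
  rw [eigenspaceA, theta_eq_ladderScale (Finite.one_lt_card (α := F)) M hd hj]
  push_cast
  rfl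

theorem ladder_mem_iSup {N M d : ℕ} (hM : 0 < M) (hH : finrank F H = N + M)
    (hh : finrank F h = M) (hv : IsLadderBase h v r c) (hdN : d ≤ N) (hd : ladder h v d ≠ 0)
    (hd1 : ladder h v (d + 1) = 0) {i : ℕ} (hi : i ≤ d) :
    ladder h v i ∈ ⨆ j : Fin (d + 1), eigenspaceA h N M (((N - d + 2 * (j : ℕ) : ℕ) : ℚ) / 2) := by
  have hcard : 1 < Nat.card F := Finite.one_lt_card
  have hγ : ((ladderScale (Nat.card F) N M d : ℝ) : ℂ) ≠ 0 := by
    exact_mod_cast (ladderScale_pos hcard N M d).ne'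
  have := ladder_mem_iSup_eigenspace (A := (qAdjMatrix h).mulVecLin) (v := ladder h v)
    (card_pow_ne_one F) (card_ne_zero F) hγ
    (fun i hi j hj => pow_sub_pow_injective hcard hi hj) (qAdjMatrix_ladder_zero hv) hd1
    (fun i _ => qAdjMatrix_ladder_succ hM hH hh hv hd hd1 i)
    (linearIndependent_ladder hv.homogeneous hd) hi
  convert this using 3 with j
  exact eigenspaceA_eq_ladderScale hdN (Nat.lt_succ_iff.1 j.2)

theorem eigenspaceA_ne_bot_of_ladder {N M d : ℕ} (hM : 0 < M) (hH : finrank F H = N + M)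
    (hh : finrank F h = M) (hv : IsLadderBase h v r c) (hdN : d ≤ N) (hd : ladder h v d ≠ 0)
    (hd1 : ladder h v (d + 1) = 0) {j : ℕ} (hj : j ≤ d) :
    eigenspaceA h N M (((N - d + 2 * j : ℕ) : ℚ) / 2) ≠ ⊥ := by
  have hcard : 1 < Nat.card F := Finite.one_lt_card
  have hγ : ((ladderScale (Nat.card F) N M d : ℝ) : ℂ) ≠ 0 := by
    exact_mod_cast (ladderScale_pos hcard N M d).ne'
  rw [eigenspaceA_eq_ladderScale hdN hj, Submodule.ne_bot_iff]
  exact ⟨_, End.mem_eigenspace_iff.2 (apply_ladderEigenvector (A := (qAdjMatrix h).mulVecLin)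
    (v := ladder h v) (card_pow_ne_one F) (card_ne_zero F) hγ (qAdjMatrix_ladder_zero hv) hd1
    (fun i _ => qAdjMatrix_ladder_succ hM hH hh hv hd hd1 i) hj),
    ladderEigenvector_ne_zero (linearIndependent_ladder hv.homogeneous hd) j⟩

end Ladder

/-! ### The ladders span the standard module -/

section Spanning

variable {F H : Type*} [Field F] [AddCommGroup H] [Module F H] [Module.Finite F H] [Finite F]
  {h : Submodule F H} {N M : ℕ}

theorem star_mulVec_raising (v : Vertex h → ℂ) : raising h *ᵥ star v = star (raising h *ᵥ v) := by
  ext y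
  simp [Matrix.mulVec, dotProduct, raising, apply_ite]

theorem star_mulVec_lowering (v : Vertex h → ℂ) :
    (raising h)ᵀ *ᵥ star v = star ((raising h)ᵀ *ᵥ v) := by
  ext y
  simp [Matrix.mulVec, dotProduct, raising, apply_ite]

theorem IsLadderBase.star {v : Vertex h → ℂ} {r : ℕ} {c : ℂ} (hv : IsLadderBase h v r c) :
    IsLadderBase h (star v) r (star c) where
  homogeneous y hy := hv.homogeneous y (star_ne_zero.1 hy)
  lowering_eq_zero := by rw [star_mulVec_lowering, hv.lowering_eq_zero, star_zero]
  lowering_raising := by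
    rw [star_mulVec_raising, star_mulVec_lowering, hv.lowering_raising, star_smul]

/-- The vectors orthogonal to all ladders, with respect to the bilinear dot product. -/
def ladderOrthogonal (h : Submodule F H) : Submodule ℂ (Vertex h → ℂ) where
  carrier := {w | ∀ v r c i, IsLadderBase h v r c → ladder h v i ⬝ᵥ w = 0}
  add_mem' ha hb v r c i hv := by rw [dotProduct_add, ha v r c i hv, hb v r c i hv, add_zero]
  zero_mem' v r c i _ := dotProduct_zero _
  smul_mem' a w hw v r c i hv := by rw [dotProduct_smul, hw v r c i hv, smul_zero]

theorem raising_mem_ladderOrthogonal (hM : 0 < M) (hH : finrank F H = N + M)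
    (hh : finrank F h = M) {w : Vertex h → ℂ} (hw : w ∈ ladderOrthogonal h) :
    raising h *ᵥ w ∈ ladderOrthogonal h := by
  intro v r c i hv
  rw [Matrix.dotProduct_mulVec, ← Matrix.mulVec_transpose]
  cases i with
  | zero => rw [ladder_zero, hv.lowering_eq_zero, zero_dotProduct]
  | succ i => rw [lowering_ladder hM hH hh hv, smul_dotProduct, hw v r c i hv, smul_zero]

theorem lowering_mem_ladderOrthogonal {w : Vertex h → ℂ} (hw : w ∈ ladderOrthogonal h) :
    (raising h)ᵀ *ᵥ w ∈ ladderOrthogonal h := by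
  intro v r c i hv
  rw [Matrix.dotProduct_mulVec, Matrix.vecMul_transpose, ← ladder_succ]
  exact hw v r c (i + 1) hv

theorem component_mem_ladderOrthogonal {w : Vertex h → ℂ} (hw : w ∈ ladderOrthogonal h) (s : ℕ) :
    (fun y => if dim y = s then w y else 0) ∈ ladderOrthogonal h := by
  intro v r c i hv
  by_cases hs : r + i = s
  · refine Eq.trans ?_ (hw v r c i hv)
    refine Finset.sum_congr rfl fun y _ => ?_
    by_cases hy : ladder h v i y = 0
    · simp [hy]
    · simp only [if_pos ((hv.homogeneous.ladder i y hy).trans hs)]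
  · refine Finset.sum_eq_zero fun y _ => ?_
    by_cases hy : ladder h v i y = 0
    · simp [hy]
    · have hd : dim y ≠ s := fun hd => hs ((hv.homogeneous.ladder i y hy).symm.trans hd)
      simp only [if_neg hd, mul_zero]

/-- The homogeneous elements of degree `s` that are orthogonal to all ladders. -/
def ladderOrthogonalOfDegree (h : Submodule F H) (s : ℕ) : Submodule ℂ (Vertex h → ℂ) where
  carrier := {w | w ∈ ladderOrthogonal h ∧ IsHomogeneous h w s}
  add_mem' {a b} ha hb := ⟨add_mem ha.1 hb.1, fun y hy => by
    by_cases hay : a y = 0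
    · exact hb.2 y fun hby => hy (by simp [hay, hby])
    · exact ha.2 y hay⟩
  zero_mem' := ⟨zero_mem _, fun y hy => absurd rfl hy⟩
  smul_mem' a w hw := ⟨Submodule.smul_mem _ a hw.1, fun y hy => hw.2 y (right_ne_zero_of_mul hy)⟩

open scoped ComplexOrder in
/-- A nonzero element of least degree in the orthogonal complement of the ladders can be chosen to
be the base of a ladder, which is then orthogonal to its own complex conjugate. -/
theorem ladderOrthogonal_eq_bot (hM : 0 < M) (hH : finrank F H = N + M) (hh : finrank F h = M) :
    ladderOrthogonal h = ⊥ := by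
  classical
  rw [Submodule.eq_bot_iff]
  intro w hw
  by_contra hw0
  have hex : ∃ s, ladderOrthogonalOfDegree h s ≠ ⊥ := by
    obtain ⟨y, hy⟩ := Function.ne_iff.1 hw0
    refine ⟨dim y, fun hbot => hy ?_⟩
    have hmem : (fun z => if dim z = dim y then w z else 0) ∈ ladderOrthogonalOfDegree h (dim y) :=
      ⟨component_mem_ladderOrthogonal hw _, fun z hz => by
        by_contra hne
        exact hz (if_neg hne)⟩
    rw [hbot, Submodule.mem_bot] at hmem
    simpa using congrFun hmem y
  set s := Nat.find hex
  have hs : ladderOrthogonalOfDegree h s ≠ ⊥ := Nat.find_spec hex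
  have hmin : ∀ t < s, ladderOrthogonalOfDegree h t = ⊥ := fun t ht =>
    not_not.1 (Nat.find_min hex ht)
  have hlow : ∀ u ∈ ladderOrthogonalOfDegree h s, (raising h)ᵀ *ᵥ u = 0 := by
    intro u hu
    by_contra hne
    obtain ⟨y, hy⟩ := Function.ne_iff.1 hne
    have hsy := hu.2.lowering y hy
    have hmem : (raising h)ᵀ *ᵥ u ∈ ladderOrthogonalOfDegree h (dim y) :=
      ⟨lowering_mem_ladderOrthogonal hu.1, fun z hz => by
        have := hu.2.lowering z hz
        omega⟩
    rw [hmin _ (by omega), Submodule.mem_bot] at hmem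
    exact hne hmem
  have hinv : ∀ u ∈ ladderOrthogonalOfDegree h s,
      ((raising h)ᵀ * raising h).mulVecLin u ∈ ladderOrthogonalOfDegree h s := by
    intro u hu
    rw [Matrix.mulVecLin_apply, ← Matrix.mulVec_mulVec]
    refine ⟨lowering_mem_ladderOrthogonal (raising_mem_ladderOrthogonal hM hH hh hu.1), ?_⟩
    intro y hy
    have := hu.2.raising.lowering y hy
    omega
  have hnt : Nontrivial (ladderOrthogonalOfDegree h s) := Submodule.nontrivial_iff_ne_bot.2 hs
  obtain ⟨c, hc⟩ := End.exists_eigenvalue (((raising h)ᵀ * raising h).mulVecLin.restrict hinv)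
  obtain ⟨⟨u, hu⟩, hcu, hu0⟩ := hc.exists_hasEigenvector
  have hbase : IsLadderBase h u s c := by
    refine ⟨hu.2, hlow u hu, ?_⟩
    have := congrArg Subtype.val (End.mem_eigenspace_iff.1 hcu)
    rw [LinearMap.coe_restrict_apply, Matrix.mulVecLin_apply, ← Matrix.mulVec_mulVec] at this
    exact this
  -- The dot product is bilinear, so definiteness is available only against the conjugate of `u`,
  -- which is again the base of a ladder because `R` is real.
  have horth := hu.1 (star u) s (star c) 0 hbase.star
  rw [ladder_zero, dotProduct_star_self_eq_zero] at horth
  exact hu0 (Subtype.ext horth)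

/-- The eigenspaces of `A` for the `θ_i` span, because they contain every ladder. -/
theorem iSup_eigenspaceA (hM : 0 < M) (hH : finrank F H = N + M) (hh : finrank F h = M) :
    ⨆ k : Fin (2 * N + 1), eigenspaceA h N M (((k : ℕ) : ℚ) / 2) = ⊤ := by
  classical
  set Y := ⨆ k : Fin (2 * N + 1), eigenspaceA h N M (((k : ℕ) : ℚ) / 2) with hY
  have hladder : ∀ v r c i, IsLadderBase h v r c → ladder h v i ∈ Y := by
    intro v r c i hv
    have hex : ∃ n, ladder h v n = 0 := ⟨N + 1, ladder_eq_zero hH hh hv.homogeneous (by omega)⟩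
    rcases lt_or_ge i (Nat.find hex) with hi | hi
    · obtain ⟨d, hd⟩ : ∃ d, Nat.find hex = d + 1 := ⟨Nat.find hex - 1, by omega⟩
      have hd0 : ladder h v d ≠ 0 := Nat.find_min hex (by omega)
      have hd1 : ladder h v (d + 1) = 0 := hd ▸ Nat.find_spec hex
      have hdN : d ≤ N := by
        by_contra hlt
        exact hd0 (ladder_eq_zero hH hh hv.homogeneous (by omega))
      have hle : ⨆ j : Fin (d + 1),
          eigenspaceA h N M (((N - d + 2 * (j : ℕ) : ℕ) : ℚ) / 2) ≤ Y := by
        refine iSup_le fun j => ?_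
        have hj := j.2
        exact le_iSup (fun k : Fin (2 * N + 1) => eigenspaceA h N M (((k : ℕ) : ℚ) / 2))
          ⟨N - d + 2 * j, by omega⟩
      exact hle (ladder_mem_iSup hM hH hh hv hdN hd0 hd1 (i := i) (by omega))
    · rw [ladder_eq_zero_of_le (Nat.find_spec hex) hi]
      exact zero_mem _
  by_contra hne
  obtain ⟨f, hf0, hf⟩ := Submodule.exists_le_ker_of_lt_top Y (lt_top_iff_ne_top.2 hne)
  have hfw : ∀ x, f x = x ⬝ᵥ fun y => f (Pi.single y 1) := fun x => by
    rw [LinearMap.pi_apply_eq_sum_univ f x]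
    refine Finset.sum_congr rfl fun y _ => ?_
    rw [smul_eq_mul]
    congr 2
    ext z
    simp [Pi.single_apply, eq_comm]
  have hw : (fun y => f (Pi.single y 1)) ∈ ladderOrthogonal h := fun v r c i hv => by
    rw [← hfw]
    exact hf (hladder v r c i hv)
  rw [ladderOrthogonal_eq_bot hM hH hh, Submodule.mem_bot] at hw
  apply hf0
  refine LinearMap.ext fun x => ?_
  rw [hfw, hw, dotProduct_zero, LinearMap.zero_apply]

end Spanning

/-! ### Points with the same span together with `h` -/

section Points

variable {F H : Type*} [Field F] [AddCommGroup H] [Module F H] {h : Submodule F H} {N M : ℕ}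

theorem exists_points_same_sup (hN : 0 < N) (hM : 0 < M) (hH : finrank F H = N + M)
    (hh : finrank F h = M) :
    ∃ y y' : Vertex h, y ≠ y' ∧ dim y = 1 ∧ dim y' = 1 ∧ y.1 ⊔ h = y'.1 ⊔ h := by
  have htop : h ≠ ⊤ := by
    rintro rfl
    rw [finrank_top] at hh
    omega
  have hbot : h ≠ ⊥ := by
    rintro rfl
    rw [finrank_bot] at hh
    omega
  obtain ⟨e, -, he⟩ := SetLike.exists_of_lt (lt_top_iff_ne_top.2 htop)
  obtain ⟨g, hg, hg0⟩ := Submodule.exists_mem_ne_zero_of_ne_bot hbot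
  have hmem : ∀ x, x ∉ h → F ∙ x ⊓ h = ⊥ := fun x hx => by
    have hx0 : x ≠ 0 := fun h0 => hx (h0 ▸ h.zero_mem)
    rwa [← disjoint_iff, disjoint_comm, Submodule.disjoint_span_singleton' hx0]
  have heg : e + g ∉ h := fun h' => he ((Submodule.add_mem_iff_left h hg).1 h')
  have hdim : ∀ x, x ∉ h → finrank F (F ∙ x) = 1 := fun x hx =>
    finrank_span_singleton fun h0 => hx (h0 ▸ h.zero_mem)
  refine ⟨⟨F ∙ e, hmem e he⟩, ⟨F ∙ (e + g), hmem _ heg⟩, ?_, hdim e he, hdim _ heg, ?_⟩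
  · intro heq
    have h1 : e + g ∈ F ∙ e := by
      have := congrArg Subtype.val heq
      simp only at this
      rw [this]
      exact Submodule.mem_span_singleton_self _
    have h2 : g ∈ F ∙ e ⊓ h :=
      ⟨(Submodule.add_mem_iff_right _ (Submodule.mem_span_singleton_self e)).1 h1, hg⟩
    rw [hmem e he, Submodule.mem_bot] at h2
    exact hg0 h2
  · refine le_antisymm (sup_le ?_ le_sup_right) (sup_le ?_ le_sup_right)
    · rw [Submodule.span_singleton_le_iff_mem]
      refine (Submodule.add_mem_iff_left _ (Submodule.mem_sup_right hg)).1 ?_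
      exact Submodule.mem_sup_left (Submodule.mem_span_singleton_self _)
    · rw [Submodule.span_singleton_le_iff_mem]
      exact add_mem (Submodule.mem_sup_left (Submodule.mem_span_singleton_self _))
        (Submodule.mem_sup_right hg)

variable [Module.Finite F H]

theorem isSibling_iff_of_finrank_eq_one {y z : Submodule F H} (hy : y ⊓ h = ⊥)
    (hy1 : finrank F y = 1) :
    IsSibling h z y ↔ (finrank F z = 1 ∧ z ≤ y ⊔ h) ∧ z ≠ y := by
  constructor
  · intro hs
    have h1 := (covBy_iff_finrank.1 hs.1).2
    have h2 := (covBy_iff_finrank.1 hs.2.1).2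
    refine ⟨⟨by omega, le_sup_left.trans ((inf_ne_bot_iff_le_sup hy hs.2.1).1 hs.2.2)⟩, ?_⟩
    rintro rfl
    exact hs.1.lt.ne (by simp)
  · rintro ⟨⟨hz1, hle⟩, hne⟩
    have h1 := Submodule.finrank_sup_add_finrank_inf_eq z y
    have h2 : z ⊓ y < z := lt_of_le_of_ne inf_le_left fun h' =>
      hne (Submodule.eq_of_le_of_finrank_eq (inf_eq_left.1 h') (hz1.trans hy1.symm))
    have h3 := Submodule.finrank_lt_finrank_of_lt h2
    have hc : y ⋖ z ⊔ y := covBy_iff_finrank.2 ⟨le_sup_right, by omega⟩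
    exact ⟨covBy_iff_finrank.2 ⟨le_sup_left, by omega⟩, hc,
      (inf_ne_bot_iff_le_sup hy hc).2 (sup_le hle le_sup_left)⟩

theorem covBy_iff_of_finrank_eq_one {y z : Submodule F H} (hy1 : finrank F y = 1) :
    z ⋖ y ↔ z = ⊥ := by
  rw [covBy_iff_finrank, hy1]
  constructor
  · rintro ⟨-, hz⟩
    exact Submodule.finrank_eq_zero.1 (by omega)
  · rintro rfl
    simp

end Points

/-! ### Every `θ_i` is an eigenvalue -/

section Existence

variable {F H : Type*} [Field F] [AddCommGroup H] [Module F H] [Module.Finite F H] [Finite F]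
  {h : Submodule F H} {N M : ℕ}

/-- For this value of `c`, none of the coefficients by which `Rᵀ` moves down the ladder vanishes
below degree `N`, so the ladder reaches the top degree of the poset. -/
theorem ladder_ne_zero {r d : ℕ} (hM : 0 < M) (hH : finrank F H = N + M) (hh : finrank F h = M)
    {v : Vertex h → ℂ} (hv0 : v ≠ 0) (hrd : r + d = N)
    (hv : IsLadderBase h v r
      ((Nat.card F : ℂ) ^ M * ((Nat.card F : ℂ) ^ d - 1) / ((Nat.card F : ℂ) - 1)))
    {i : ℕ} (hi : i ≤ d) : ladder h v i ≠ 0 := by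
  have hq := card_ne_zero F
  have hq1 := card_sub_one_ne_zero F
  induction i with
  | zero => rwa [ladder_zero]
  | succ i ih =>
    intro h0
    have h1 := lowering_ladder hM hH hh hv i
    rw [h0, Matrix.mulVec_zero, eq_comm, smul_eq_zero_iff_left (ih (by omega))] at h1
    obtain ⟨s, rfl⟩ := Nat.exists_eq_add_of_lt (Nat.lt_of_succ_le hi)
    have h2 : ladderCoeff F N M r ((Nat.card F : ℂ) ^ M * ((Nat.card F : ℂ) ^ (i + s + 1) - 1) /
        ((Nat.card F : ℂ) - 1)) (i + 1) = ((Nat.card F : ℂ) ^ (i + 1) - 1) *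
        ((Nat.card F : ℂ) ^ M * ((Nat.card F : ℂ) ^ (s + 1) - 1) / ((Nat.card F : ℂ) - 1) ^ 2) := by
      rw [ladderCoeff, ladderConst, ← hrd]
      field_simp
      ring
    rw [h2] at h1
    exact mul_ne_zero (sub_ne_zero.2 (card_pow_ne_one F _ (by omega)))
      (div_ne_zero (mul_ne_zero (pow_ne_zero _ hq)
        (sub_ne_zero.2 (card_pow_ne_one F _ (by omega)))) (pow_ne_zero _ hq1)) h1

theorem updownDiagonal_mulVec {v : Vertex h → ℂ} {r : ℕ} (hv : IsHomogeneous h v r) :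
    updownDiagonal h N M *ᵥ v = ((((Nat.card F : ℂ) ^ r - 1) -
      ((Nat.card F : ℂ) ^ (N + M - r) - (Nat.card F : ℂ) ^ M)) / ((Nat.card F : ℂ) - 1)) • v := by
  ext y
  rw [updownDiagonal, Matrix.mulVec_diagonal, Pi.smul_apply, smul_eq_mul]
  by_cases hy : v y = 0
  · simp [hy]
  · rw [hv y hy]

theorem lowering_raising_mulVec {v : Vertex h → ℂ} {r : ℕ} (hH : finrank F H = N + M)
    (hh : finrank F h = M) (hv : IsHomogeneous h v r) (hlow : (raising h)ᵀ *ᵥ v = 0) :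
    (raising h)ᵀ *ᵥ (raising h *ᵥ v) = (-(((Nat.card F : ℂ) ^ r - 1) -
      ((Nat.card F : ℂ) ^ (N + M - r) - (Nat.card F : ℂ) ^ M)) / ((Nat.card F : ℂ) - 1)) • v -
      sibling h *ᵥ v := by
  have := congrArg (· *ᵥ v) (raising_commutator hH hh)
  simp only [Matrix.sub_mulVec, Matrix.add_mulVec, ← Matrix.mulVec_mulVec, hlow, Matrix.mulVec_zero,
    updownDiagonal_mulVec hv] at this
  rw [neg_div, neg_smul, ← sub_eq_zero]
  rw [← sub_eq_zero] at this
  rw [← neg_eq_zero, ← this]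
  abel

theorem isLadderBase_single_bot (hH : finrank F H = N + M) (hh : finrank F h = M) :
    IsLadderBase h (Pi.single ⟨⊥, bot_inf_eq h⟩ 1) 0
      ((Nat.card F : ℂ) ^ M * ((Nat.card F : ℂ) ^ N - 1) / ((Nat.card F : ℂ) - 1)) := by
  classical
  have hom : IsHomogeneous h (Pi.single ⟨⊥, bot_inf_eq h⟩ 1) 0 := by
    intro y hy
    by_cases hb : y = ⟨⊥, bot_inf_eq h⟩
    · rw [hb, dim, finrank_bot]
    · simp [hb] at hy
  have hlow : (raising h)ᵀ *ᵥ Pi.single ⟨⊥, bot_inf_eq h⟩ 1 = 0 := by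
    ext y
    by_contra hy
    have := hom.lowering y hy
    omega
  have hsib : sibling h *ᵥ Pi.single ⟨⊥, bot_inf_eq h⟩ 1 = 0 := by
    ext y
    rw [Matrix.mulVec_single_one]
    refine if_neg fun hs : IsSibling h y.1 ⊥ => hs.1.lt.ne ?_
    simp
  refine ⟨hom, hlow, ?_⟩
  rw [lowering_raising_mulVec hH hh hom hlow, hsib, sub_zero]
  congr 2
  rw [pow_zero, Nat.sub_zero]
  ring

/-- The points `y` and `y'` have the same siblings apart from each other, so the sibling matrix acts
on their difference as `-1`. -/
theorem isLadderBase_single_sub_single (hH : finrank F H = N + M)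
    (hh : finrank F h = M) {y y' : Vertex h} (hne : y ≠ y') (hy : dim y = 1) (hy' : dim y' = 1)
    (hsup : y.1 ⊔ h = y'.1 ⊔ h) :
    IsLadderBase h (Pi.single y 1 - Pi.single y' 1) 1
      ((Nat.card F : ℂ) ^ M * ((Nat.card F : ℂ) ^ (N - 1) - 1) / ((Nat.card F : ℂ) - 1)) := by
  classical
  have hq1 := card_sub_one_ne_zero F
  have hom : IsHomogeneous h (Pi.single y 1 - Pi.single y' 1) 1 := by
    intro z hz
    by_cases h1 : z = y
    · rw [h1, hy]
    · by_cases h2 : z = y'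
      · rw [h2, hy']
      · simp [h1, h2] at hz
  have hlow : (raising h)ᵀ *ᵥ (Pi.single y 1 - Pi.single y' 1) = 0 := by
    rw [Matrix.mulVec_sub, Matrix.mulVec_single_one, Matrix.mulVec_single_one]
    ext z
    simp only [Pi.sub_apply, Matrix.col_apply, Matrix.transpose_apply, raising, Matrix.of_apply]
    rw [if_congr (covBy_iff_of_finrank_eq_one hy) rfl rfl,
      if_congr (covBy_iff_of_finrank_eq_one hy') rfl rfl, sub_self, Pi.zero_apply]
  have hsib : sibling h *ᵥ (Pi.single y 1 - Pi.single y' 1) =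
      -(Pi.single y 1 - Pi.single y' 1) := by
    rw [Matrix.mulVec_sub, Matrix.mulVec_single_one, Matrix.mulVec_single_one]
    ext z
    simp only [Pi.sub_apply, Matrix.col_apply, sibling, Matrix.of_apply, Pi.neg_apply,
      Pi.single_apply]
    rw [if_congr (isSibling_iff_of_finrank_eq_one y.2 hy) rfl rfl,
      if_congr (isSibling_iff_of_finrank_eq_one y'.2 hy') rfl rfl, hsup]
    have hy0 : finrank F y.1 = 1 ∧ y.1 ≤ y'.1 ⊔ h := ⟨hy, hsup ▸ le_sup_left⟩
    have hy0' : finrank F y'.1 = 1 ∧ y'.1 ≤ y'.1 ⊔ h := ⟨hy', le_sup_left⟩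
    by_cases h1 : z = y
    · subst h1
      simp [hne, hy0, Subtype.val_injective.ne hne]
    · by_cases h2 : z = y'
      · subst h2
        simp [hne.symm, hy0', Subtype.val_injective.ne hne.symm]
      · simp [h1, h2, Subtype.val_injective.ne h1, Subtype.val_injective.ne h2]
  refine ⟨hom, hlow, ?_⟩
  have hN := Vertex.dim_le hH hh y
  obtain ⟨n, rfl⟩ : ∃ n, N = n + 1 := ⟨N - 1, by omega⟩
  rw [lowering_raising_mulVec hH hh hom hlow, hsib, sub_neg_eq_add]
  nth_rewrite 2 [← one_smul ℂ (Pi.single y 1 - Pi.single y' 1)]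
  rw [← add_smul]
  congr 1
  rw [show n + 1 + M - 1 = n + M by omega, Nat.add_sub_cancel]
  field_simp
  ring

/-- The integer indices are realized by the ladder of the zero subspace, the half-integer ones by
the ladder of a difference of two points with the same span together with `h`. -/
theorem eigenspaceA_ne_bot (hN : 0 < N) (hM : 0 < M) (hH : finrank F H = N + M)
    (hh : finrank F h = M) {k : ℕ} (hk : k ≤ 2 * N) :
    eigenspaceA h N M ((k : ℚ) / 2) ≠ ⊥ := by
  classical
  rcases Nat.even_or_odd' k with ⟨j, rfl | rfl⟩
  · have hbase := isLadderBase_single_bot hH hh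
    have hne : (Pi.single ⟨⊥, bot_inf_eq h⟩ 1 : Vertex h → ℂ) ≠ 0 := by simp
    have := eigenspaceA_ne_bot_of_ladder hM hH hh hbase le_rfl
      (ladder_ne_zero hM hH hh hne (zero_add N) hbase le_rfl)
      (ladder_eq_zero hH hh hbase.homogeneous (by omega)) (j := j) (by omega)
    rwa [Nat.sub_self, zero_add] at this
  · obtain ⟨y, y', hyy', hy, hy', hsup⟩ := exists_points_same_sup hN hM hH hh
    have hbase := isLadderBase_single_sub_single hH hh hyy' hy hy' hsup
    have hne : (Pi.single y 1 - Pi.single y' 1 : Vertex h → ℂ) ≠ 0 := fun h0 => by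
      have := congrFun h0 y
      simp [hyy'] at this
    have := eigenspaceA_ne_bot_of_ladder hM hH hh hbase (Nat.sub_le N 1)
      (ladder_ne_zero hM hH hh hne (by omega) hbase le_rfl)
      (ladder_eq_zero hH hh hbase.homogeneous (by omega)) (j := j) (by omega)
    rwa [show N - (N - 1) + 2 * j = 2 * j + 1 by omega] at this

end Existence

/-! ### Tridiagonality -/

section Tridiagonal

open Polynomial in
/-- If the eigenspaces for the `μ i` span and `p(T)` kills `w`, then `w` has components only in the
eigenspaces for the roots of `p`. -/
theorem mem_iSup_eigenspace_of_aeval_eq_zero {V ι : Type*} [AddCommGroup V] [Module ℂ V] [Fintype ι]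
    (T : End ℂ V) {μ : ι → ℂ} (hμ : Function.Injective μ)
    (htop : ⨆ i, End.eigenspace T (μ i) = ⊤) (p : ℂ[X]) {w : V} (hw : aeval T p w = 0) :
    w ∈ ⨆ i, ⨆ _ : p.eval (μ i) = 0, End.eigenspace T (μ i) := by
  classical
  have hmem : w ∈ ⨆ i, End.eigenspace T (μ i) := htop ▸ Submodule.mem_top
  obtain ⟨u, hu, hsum⟩ := (Submodule.mem_iSup_iff_exists_finsupp _ _).1 hmem
  rw [Finsupp.sum_fintype _ _ fun _ => rfl] at hsum
  have happ : ∀ i, aeval T p (u i) = p.eval (μ i) • u i := fun i => by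
    by_cases h0 : u i = 0
    · simp [h0]
    · exact End.aeval_apply_of_hasEigenvector ⟨hu i, h0⟩
  have hind := (End.eigenspaces_iSupIndep T).comp hμ
  rw [iSupIndep_iff_finsetSum_eq_zero_imp_eq_zero] at hind
  rw [← hsum, map_sum, Finset.sum_congr rfl fun i _ => happ i] at hw
  have hzero := hind Finset.univ _ (fun i _ => Submodule.smul_mem _ _ (hu i)) hw
  rw [← hsum]
  refine Submodule.sum_mem _ fun i _ => ?_
  rcases smul_eq_zero.1 (hzero i (Finset.mem_univ i)) with h1 | h1
  · exact Submodule.mem_iSup_of_mem i (Submodule.mem_iSup_of_mem h1 (hu i))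
  · rw [h1]
    exact zero_mem _

theorem theta_add_one_add_theta_sub_one {q : ℕ} (hq : 1 < q) (N M : ℕ) (i : ℚ) :
    theta q N M (i + 1) + theta q N M (i - 1) = ((q : ℝ) + (q : ℝ)⁻¹) * theta q N M i := by
  have hq' : (1 : ℝ) < q := by exact_mod_cast hq
  have hq0 : (0 : ℝ) < q := by linarith
  have hne : (q : ℝ) - 1 ≠ 0 := by linarith
  have ht := Real.rpow_pos_of_pos hq0 (i : ℝ)
  unfold theta
  push_cast
  rw [show (N : ℝ) - (i + 1) = N - i - 1 by ring, show (N : ℝ) - (i - 1) = N - i + 1 by ring]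
  simp only [Real.rpow_sub hq0, Real.rpow_add hq0, Real.rpow_one]
  field_simp
  ring

theorem theta_add_one_mul_theta_sub_one {q : ℕ} (hq : 1 < q) {N M : ℕ} (hM : 0 < M) (i : ℚ) :
    theta q N M (i + 1) * theta q N M (i - 1) =
      theta q N M i ^ 2 - ((q : ℝ) + 1) ^ 2 * (q : ℝ)⁻¹ * (q : ℝ) ^ (N + M - 1) := by
  have hq' : (1 : ℝ) < q := by exact_mod_cast hq
  have hq0 : (0 : ℝ) < q := by linarith
  have hne : (q : ℝ) - 1 ≠ 0 := by linarith
  have ht := Real.rpow_pos_of_pos hq0 (i : ℝ)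
  obtain ⟨m, rfl⟩ : ∃ m, M = m + 1 := ⟨M - 1, by omega⟩
  have hs : ((q : ℝ) ^ (((m + 1 : ℕ) : ℝ) / 2)) ^ 2 = (q : ℝ) ^ (m + 1) := by
    rw [← Real.rpow_natCast, ← Real.rpow_mul hq0.le, ← Real.rpow_natCast]
    congr 1
    push_cast
    ring
  unfold theta
  set s := (q : ℝ) ^ (((m + 1 : ℕ) : ℝ) / 2)
  push_cast
  rw [show (N : ℝ) - (i + 1) = N - i - 1 by ring, show (N : ℝ) - (i - 1) = N - i + 1 by ring,
    show N + (m + 1) - 1 = N + m by omega]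
  simp only [Real.rpow_sub hq0, Real.rpow_add hq0, Real.rpow_one, Real.rpow_natCast]
  field_simp
  rw [hs]
  ring

variable {F H : Type*} [Field F] [AddCommGroup H] [Module F H] [Module.Finite F H] [Finite F]
  {h : Submodule F H} {N M : ℕ}

open Polynomial in
/-- The element `W` commuting with `A` in `casimir_commute` takes the form
`(A - θ_{i+1}) (A - θ_{i-1}) A*` on `E_i V`. -/
theorem aeval_dualMatrix_mulVec (hM : 0 < M) (hH : finrank F H = N + M) (hh : finrank F h = M)
    {i : ℚ} {v : Vertex h → ℂ} (hv : v ∈ eigenspaceA h N M i) :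
    aeval (qAdjMatrix h).mulVecLin
      ((X - C ((theta (Nat.card F) N M i : ℝ) : ℂ)) *
        ((X - C ((theta (Nat.card F) N M (i + 1) : ℝ) : ℂ)) *
          (X - C ((theta (Nat.card F) N M (i - 1) : ℝ) : ℂ)))) (dualMatrix h *ᵥ v) = 0 := by
  have hcard : 1 < Nat.card F := Finite.one_lt_card
  have hadd : ((theta (Nat.card F) N M (i + 1) : ℝ) : ℂ) +
      ((theta (Nat.card F) N M (i - 1) : ℝ) : ℂ) =
      ((Nat.card F : ℂ) + (Nat.card F : ℂ)⁻¹) * ((theta (Nat.card F) N M i : ℝ) : ℂ) := by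
    have := congrArg Complex.ofReal (theta_add_one_add_theta_sub_one hcard N M i)
    push_cast at this
    exact this
  have hmul : ((theta (Nat.card F) N M (i + 1) : ℝ) : ℂ) *
      ((theta (Nat.card F) N M (i - 1) : ℝ) : ℂ) =
      ((theta (Nat.card F) N M i : ℝ) : ℂ) ^ 2 - ((Nat.card F : ℂ) + 1) ^ 2 * (Nat.card F : ℂ)⁻¹ *
        (Nat.card F : ℂ) ^ (N + M - 1) := by
    have := congrArg Complex.ofReal (theta_add_one_mul_theta_sub_one hcard (N := N) hM i)
    push_cast at this
    exact this
  set a : ℂ := ((theta (Nat.card F) N M i : ℝ) : ℂ)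
  set b : ℂ := ((theta (Nat.card F) N M (i + 1) : ℝ) : ℂ)
  set c : ℂ := ((theta (Nat.card F) N M (i - 1) : ℝ) : ℂ)
  have hAv : qAdjMatrix h *ᵥ v = a • v := End.mem_eigenspace_iff.1 hv
  have hcomm := casimir_commute (card_ne_zero F) (raising_mul_dualMatrix (h := h))
    dualMatrix_mul_lowering dualMatrix_mul_inv inv_mul_dualMatrix (uniform_lowering hH hh)
    (uniform_raising hH hh)
  have htri := tridiagonal_expression (card_ne_zero F) (raising_mul_dualMatrix (h := h))
    dualMatrix_mul_lowering dualMatrix_mul_inv inv_mul_dualMatrix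
  rw [← htri, ← qAdjMatrix_eq] at hcomm
  set A := qAdjMatrix h
  set K := dualMatrix h
  have hW := congrArg (· *ᵥ v) hcomm.eq
  simp only [Matrix.sub_mulVec, Matrix.add_mulVec, Matrix.smul_mulVec, ← Matrix.mulVec_mulVec, hAv,
    Matrix.mulVec_smul, Matrix.mulVec_sub, Matrix.mulVec_add] at hW
  simp only [map_mul, map_sub, aeval_X, aeval_C, Module.End.mul_apply, LinearMap.sub_apply,
    Matrix.mulVecLin_apply, Module.algebraMap_end_apply, Matrix.mulVec_smul]
  set x₀ := K *ᵥ v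
  set x₁ := A *ᵥ x₀
  set x₂ := A *ᵥ x₁
  set x₃ := A *ᵥ x₂
  have hexpand : x₃ - c • x₂ - b • (x₂ - c • x₁) - a • (x₂ - c • x₁ - b • (x₁ - c • x₀)) =
      x₃ - (a + (b + c)) • x₂ + (a * (b + c) + b * c) • x₁ - (a * (b * c)) • x₀ := by module
  rw [hadd, hmul] at hexpand
  linear_combination (norm := module) hexpand + hW

end Tridiagonal

/-! ### `A*` generates `M*` -/

section DualAlgebra

variable {F H : Type*} [Field F] [AddCommGroup H] [Module F H] [Module.Finite F H] [Finite F]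
  {h : Submodule F H} {N M : ℕ}

open Polynomial in
theorem aeval_diagonal {X : Type*} [Fintype X] [DecidableEq X] (f : X → ℂ) (p : ℂ[X]) :
    aeval (Matrix.diagonal f) p = Matrix.diagonal fun y => p.eval (f y) := by
  have h1 := aeval_algHom_apply (Matrix.diagonalAlgHom (n := X) (α := ℂ) ℂ) f p
  rw [Matrix.diagonalAlgHom_apply, Matrix.diagonalAlgHom_apply] at h1
  rw [h1]
  congr 1
  ext y
  have h2 := aeval_algHom_apply (Pi.evalAlgHom ℂ (fun _ : X => ℂ) y) f p
  rw [Pi.evalAlgHom_apply, Pi.evalAlgHom_apply] at h2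
  rw [← h2, coe_aeval_eq_eval]

/-- `A*` has distinct entries on the subconstituents, so each `E*_i` is a Lagrange interpolation
polynomial in `A*`. -/
theorem adjoin_dualMatrix (hH : finrank F H = N + M) (hh : finrank F h = M) :
    Algebra.adjoin ℂ {dualMatrix h} = dualAlgebra h N := by
  have hcard : 1 < Nat.card F := Finite.one_lt_card
  apply le_antisymm
  · rw [dualAlgebra, Algebra.adjoin_le_iff, Set.singleton_subset_iff, SetLike.mem_coe]
    have hsum : dualMatrix h = ∑ i ∈ Finset.range (N + 1),
        ((Nat.card F : ℂ) ^ (-(i : ℤ))) • dualIdempotent h i := by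
      ext y z
      rw [Matrix.sum_apply]
      by_cases hyz : y = z
      · subst hyz
        simp only [dualMatrix, dualIdempotent, Matrix.smul_apply, Matrix.diagonal_apply_eq,
          smul_eq_mul, mul_ite, mul_one, mul_zero]
        rw [Finset.sum_ite_eq, if_pos]
        exact Finset.mem_range.2 (Nat.lt_succ_of_le (Vertex.dim_le hH hh y))
      · simp [dualMatrix, dualIdempotent, Matrix.diagonal_apply_ne _ hyz]
    rw [hsum]
    refine Subalgebra.sum_mem _ fun i hi => Subalgebra.smul_mem _ (Algebra.subset_adjoin ?_) _
    exact ⟨i, Nat.lt_succ_iff.1 (Finset.mem_range.1 hi), rfl⟩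
  · rw [dualAlgebra, Algebra.adjoin_le_iff]
    rintro _ ⟨i, hi, rfl⟩
    set p := Lagrange.basis (Finset.range (N + 1)) (fun j : ℕ => (Nat.card F : ℂ) ^ (-(j : ℤ))) i
    have hinj : Function.Injective fun j : ℕ => (Nat.card F : ℂ) ^ (-(j : ℤ)) := by
      intro j k hjk
      simp only [_root_.zpow_neg, zpow_natCast, _root_.inv_inj] at hjk
      exact Nat.pow_right_injective hcard (by dsimp only; exact_mod_cast hjk)
    have hp : dualIdempotent h i = Polynomial.aeval (dualMatrix h) p := by
      rw [dualMatrix, aeval_diagonal, dualIdempotent]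
      congr 1
      ext y
      split_ifs with hy
      · rw [hy]
        exact (Lagrange.eval_basis_self (fun _ _ _ _ h' => hinj h')
          (Finset.mem_range.2 (Nat.lt_succ_of_le hi))).symm
      · exact (Lagrange.eval_basis_of_ne (v := fun j : ℕ => (Nat.card F : ℂ) ^ (-(j : ℤ)))
          (fun h' => hy h'.symm)
          (Finset.mem_range.2 (Nat.lt_succ_of_le (Vertex.dim_le hH hh y)))).symm
    rw [hp]
    exact Polynomial.aeval_mem_adjoin_singleton ℂ _

end DualAlgebra

/-! ### The two orderings -/

section Orderings

variable {F H : Type*} [Field F] [AddCommGroup H] [Module F H] [Module.Finite F H] [Finite F]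
  {h : Submodule F H} {N M : ℕ}

theorem isDiagonalizable (hM : 0 < M) (hH : finrank F H = N + M) (hh : finrank F h = M) :
    QPolynomial.IsDiagonalizable (qAdjMatrix h) := by
  rw [QPolynomial.IsDiagonalizable, eq_top_iff, ← iSup_eigenspaceA hM hH hh]
  exact iSup_le fun k => le_iSup (fun μ => End.eigenspace (qAdjMatrix h).mulVecLin μ) _

variable {idx : Fin (2 * N + 1) → ℚ} (σ : Equiv.Perm (Fin (2 * N + 1)))

theorem iSup_eigenspaceA_of_perm (hM : 0 < M) (hH : finrank F H = N + M) (hh : finrank F h = M)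
    (hσ : ∀ k, idx k = ((σ k : ℕ) : ℚ) / 2) : ⨆ k, eigenspaceA h N M (idx k) = ⊤ := by
  rw [← iSup_eigenspaceA hM hH hh,
    ← σ.iSup_comp (g := fun k : Fin (2 * N + 1) => eigenspaceA h N M (((k : ℕ) : ℚ) / 2))]
  simp only [hσ]

theorem injective_of_perm (hσ : ∀ k, idx k = ((σ k : ℕ) : ℚ) / 2) : Function.Injective idx := by
  intro i j hij
  rw [hσ, hσ, div_left_inj' (by norm_num)] at hij
  exact σ.injective (Fin.ext (by exact_mod_cast hij))

theorem theta_idx_injective (F : Type*) [Field F] [Finite F] (M : ℕ)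
    (hσ : ∀ k, idx k = ((σ k : ℕ) : ℚ) / 2) :
    Function.Injective fun k => ((theta (Nat.card F) N M (idx k) : ℝ) : ℂ) := fun _ _ hij =>
  injective_of_perm σ hσ
    ((theta_strictAnti (Finite.one_lt_card (α := F)) N M).injective (Complex.ofReal_injective hij))

theorem isEigenspaceOrdering_of_perm (hN : 0 < N) (hM : 0 < M) (hH : finrank F H = N + M)
    (hh : finrank F h = M) (hσ : ∀ k, idx k = ((σ k : ℕ) : ℚ) / 2) :
    QPolynomial.IsEigenspaceOrdering (qAdjMatrix h) fun k => eigenspaceA h N M (idx k) := by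
  have hne : ∀ k, eigenspaceA h N M (idx k) ≠ ⊥ := fun k => by
    rw [hσ]
    exact eigenspaceA_ne_bot hN hM hH hh (Nat.lt_succ_iff.1 (σ k).2)
  have hind := End.eigenspaces_iSupIndep (qAdjMatrix h).mulVecLin
  constructor
  · intro i j hij
    by_contra hne'
    have hd := hind.pairwiseDisjoint ((theta_idx_injective σ F M hσ).ne hne')
    have hd' : Disjoint (eigenspaceA h N M (idx i)) (eigenspaceA h N M (idx j)) := hd
    have hij' : eigenspaceA h N M (idx i) = eigenspaceA h N M (idx j) := hij
    rw [← hij', disjoint_self] at hd'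
    exact hne i hd'
  · ext W
    constructor
    · rintro ⟨k, rfl⟩
      exact ⟨_, hne k, rfl⟩
    · rintro ⟨μ, hμ, rfl⟩
      by_contra hW
      have hle : ⨆ k, eigenspaceA h N M (idx k) ≤ ⨆ (ν : ℂ) (_ : ν ≠ μ),
          End.eigenspace (qAdjMatrix h).mulVecLin ν := by
        refine iSup_le fun k => ?_
        refine le_iSup₂_of_le _ (fun heq => hW ⟨k, ?_⟩) le_rfl
        simp only [eigenspaceA, heq]
      rw [iSup_eigenspaceA_of_perm σ hM hH hh hσ] at hle
      have hd := hind μ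
      rw [top_le_iff.1 hle, disjoint_top] at hd
      exact hμ hd

/-- An ordering in which indices differing by `1` are adjacent has `A*` as a dual adjacency
matrix. -/
theorem isDualAdjacency_of_perm (hM : 0 < M) (hH : finrank F H = N + M)
    (hh : finrank F h = M) (hσ : ∀ k, idx k = ((σ k : ℕ) : ℚ) / 2)
    (hidx : ∀ i j, idx j = idx i + 1 → (j : ℕ) = (i : ℕ) + 1) :
    QPolynomial.IsDualAdjacency (dualAlgebra h N) (fun k => eigenspaceA h N M (idx k))
      (dualMatrix h) := by
  refine ⟨adjoin_dualMatrix hH hh, fun i => ?_⟩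
  rintro _ ⟨v, hv, rfl⟩
  have hmem := mem_iSup_eigenspace_of_aeval_eq_zero (qAdjMatrix h).mulVecLin
    (theta_idx_injective σ F M hσ) (iSup_eigenspaceA_of_perm σ hM hH hh hσ) _
    (aeval_dualMatrix_mulVec hM hH hh hv)
  refine SetLike.le_def.1 (iSup_mono fun j => ?_) hmem
  refine iSup_le fun hroot => ?_
  have hinj : ∀ a b : ℚ, ((theta (Nat.card F) N M a : ℝ) : ℂ) -
      ((theta (Nat.card F) N M b : ℝ) : ℂ) = 0 → a = b := fun a b hab =>
    (theta_strictAnti (Finite.one_lt_card (α := F)) N M).injective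
      (Complex.ofReal_injective (sub_eq_zero.1 hab))
  have hj : (j : ℕ) ≤ (i : ℕ) + 1 ∧ (i : ℕ) ≤ (j : ℕ) + 1 := by
    simp only [Polynomial.eval_mul, Polynomial.eval_sub, Polynomial.eval_X, Polynomial.eval_C,
      mul_eq_zero] at hroot
    rcases hroot with h1 | h1 | h1
    · have := injective_of_perm σ hσ (hinj _ _ h1)
      rw [this]
      omega
    · have := hidx i j (hinj _ _ h1)
      omega
    · have := hidx j i (by rw [hinj _ _ h1]; ring)
      omega
  exact le_iSup_of_le hj le_rfl

theorem exists_perm_of_injective {n : ℕ} (f : Fin n → ℕ) (hf : ∀ k, f k < n)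
    (hinj : ∀ i j, f i = f j → i = j) :
    ∃ σ : Equiv.Perm (Fin n), ∀ k, (σ k : ℕ) = f k :=
  ⟨Equiv.ofBijective (fun k => ⟨f k, hf k⟩) (Finite.injective_iff_bijective.1 fun i j hij =>
    hinj i j (congrArg Fin.val hij)), fun _ => rfl⟩

theorem exists_perm_indexIntFirst (N : ℕ) :
    ∃ σ : Equiv.Perm (Fin (2 * N + 1)), ∀ k, indexIntFirst N k = ((σ k : ℕ) : ℚ) / 2 := by
  obtain ⟨σ, hσ⟩ := exists_perm_of_injective (n := 2 * N + 1)
    (fun k => if (k : ℕ) ≤ N then 2 * (k : ℕ) else 2 * ((k : ℕ) - N) - 1)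
    (fun k => by have := k.2; split_ifs <;> omega)
    (fun i j hij => by
      apply Fin.ext
      split_ifs at hij <;> omega)
  refine ⟨σ, fun k => ?_⟩
  rw [hσ, indexIntFirst]
  split_ifs with hk
  · push_cast
    ring
  · obtain ⟨t, ht⟩ : ∃ t, (k : ℕ) = N + t + 1 := ⟨k - N - 1, by omega⟩
    rw [ht, show 2 * (N + t + 1 - N) - 1 = 2 * t + 1 by omega]
    push_cast
    ring

theorem exists_perm_indexHalfFirst (N : ℕ) :
    ∃ σ : Equiv.Perm (Fin (2 * N + 1)), ∀ k, indexHalfFirst N k = ((σ k : ℕ) : ℚ) / 2 := by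
  obtain ⟨σ, hσ⟩ := exists_perm_of_injective (n := 2 * N + 1)
    (fun k => if (k : ℕ) < N then 2 * (k : ℕ) + 1 else 2 * ((k : ℕ) - N))
    (fun k => by have := k.2; split_ifs <;> omega)
    (fun i j hij => by
      apply Fin.ext
      split_ifs at hij <;> omega)
  refine ⟨σ, fun k => ?_⟩
  rw [hσ, indexHalfFirst]
  split_ifs with hk
  · push_cast
    ring
  · obtain ⟨t, ht⟩ : ∃ t, (k : ℕ) = N + t := ⟨k - N, by omega⟩
    rw [ht, show 2 * (N + t - N) = 2 * t by omega]
    push_cast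
    ring

theorem indexIntFirst_succ {N : ℕ} {i j : Fin (2 * N + 1)}
    (hij : indexIntFirst N j = indexIntFirst N i + 1) : (j : ℕ) = (i : ℕ) + 1 := by
  unfold indexIntFirst at hij
  split_ifs at hij with h1 h2 h2
  · exact_mod_cast hij
  · have : (2 * (j : ℕ) + 2 * N : ℚ) = 2 * (i : ℕ) + 1 := by linarith
    have : 2 * (j : ℕ) + 2 * N = 2 * (i : ℕ) + 1 := by exact_mod_cast this
    omega
  · have : (2 * (j : ℕ) : ℚ) = 2 * (i : ℕ) + 2 * N + 3 := by linarith
    have : 2 * (j : ℕ) = 2 * (i : ℕ) + 2 * N + 3 := by exact_mod_cast this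
    omega
  · have : ((j : ℕ) : ℚ) = (i : ℕ) + 1 := by linarith
    exact_mod_cast this

theorem indexHalfFirst_succ {N : ℕ} {i j : Fin (2 * N + 1)}
    (hij : indexHalfFirst N j = indexHalfFirst N i + 1) : (j : ℕ) = (i : ℕ) + 1 := by
  unfold indexHalfFirst at hij
  split_ifs at hij with h1 h2 h2
  · have : ((j : ℕ) : ℚ) = (i : ℕ) + 1 := by linarith
    exact_mod_cast this
  · have : (2 * (j : ℕ) + 2 * N : ℚ) = 2 * (i : ℕ) + 1 := by linarith
    have : 2 * (j : ℕ) + 2 * N = 2 * (i : ℕ) + 1 := by exact_mod_cast this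
    omega
  · have : (2 * (j : ℕ) : ℚ) = 2 * (i : ℕ) + 2 * N + 3 := by linarith
    have : 2 * (j : ℕ) = 2 * (i : ℕ) + 2 * N + 3 := by exact_mod_cast this
    omega
  · have : ((j : ℕ) : ℚ) = (i : ℕ) + 1 := by linarith
    exact_mod_cast this

end Orderings

end AttenuatedSpace

theorem theorem10 {F H : Type*} [Field F] [Finite F] [AddCommGroup H] [Module F H]
    [Module.Finite F H] (N M : ℕ) (hN : 0 < N) (hM : 0 < M)
    (hH : Module.finrank F H = N + M) (h : Submodule F H) (hh : Module.finrank F h = M) :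
    -- `A` is diagonalizable
    QPolynomial.IsDiagonalizable (AttenuatedSpace.qAdjMatrix h) ∧
    -- both sequences list each of the eigenspaces of `A` exactly once
    QPolynomial.IsEigenspaceOrdering (AttenuatedSpace.qAdjMatrix h)
      (fun k => AttenuatedSpace.eigenspaceA h N M (AttenuatedSpace.indexIntFirst N k)) ∧
    QPolynomial.IsEigenspaceOrdering (AttenuatedSpace.qAdjMatrix h)
      (fun k => AttenuatedSpace.eigenspaceA h N M (AttenuatedSpace.indexHalfFirst N k)) ∧
    -- `A*` is a dual adjacency matrix for both orderings
    QPolynomial.IsDualAdjacency (AttenuatedSpace.dualAlgebra h N)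
      (fun k => AttenuatedSpace.eigenspaceA h N M (AttenuatedSpace.indexIntFirst N k))
      (AttenuatedSpace.dualMatrix h) ∧
    QPolynomial.IsDualAdjacency (AttenuatedSpace.dualAlgebra h N)
      (fun k => AttenuatedSpace.eigenspaceA h N M (AttenuatedSpace.indexHalfFirst N k))
      (AttenuatedSpace.dualMatrix h) ∧
    -- both orderings are `Q`-polynomial
    QPolynomial.IsQPolynomialOrdering (AttenuatedSpace.qAdjMatrix h)
      (AttenuatedSpace.dualAlgebra h N)
      (fun k => AttenuatedSpace.eigenspaceA h N M (AttenuatedSpace.indexIntFirst N k)) ∧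
    QPolynomial.IsQPolynomialOrdering (AttenuatedSpace.qAdjMatrix h)
      (AttenuatedSpace.dualAlgebra h N)
      (fun k => AttenuatedSpace.eigenspaceA h N M (AttenuatedSpace.indexHalfFirst N k)) ∧
    -- `A` is `Q`-polynomial
    QPolynomial.IsQPolynomial (AttenuatedSpace.qAdjMatrix h)
      (AttenuatedSpace.dualAlgebra h N) := by
  obtain ⟨σ, hσ⟩ := AttenuatedSpace.exists_perm_indexIntFirst N
  obtain ⟨τ, hτ⟩ := AttenuatedSpace.exists_perm_indexHalfFirst N
  have hdiag := AttenuatedSpace.isDiagonalizable hM hH hh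
  have hord := AttenuatedSpace.isEigenspaceOrdering_of_perm σ hN hM hH hh hσ
  have hord' := AttenuatedSpace.isEigenspaceOrdering_of_perm τ hN hM hH hh hτ
  have hdual := AttenuatedSpace.isDualAdjacency_of_perm σ hM hH hh hσ
    fun _ _ => AttenuatedSpace.indexIntFirst_succ
  have hdual' := AttenuatedSpace.isDualAdjacency_of_perm τ hM hH hh hτ
    fun _ _ => AttenuatedSpace.indexHalfFirst_succ
  exact ⟨hdiag, hord, hord', hdual, hdual', ⟨hord, _, hdual⟩, ⟨hord', _, hdual'⟩,
    hdiag, _, _, hord, _, hdual⟩
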